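/- **Setting.** Let $d\ge 1$, let $\Theta\subset\mathbb R^d$ be compact, let $\mathcal P(\Theta)$ be the set of Borel probability measures supported on $\Theta$, and let $\sigma>0$. Let $\phi_\sigma$ be the density of $\mathcal N(0,\sigma^2 I_d)$ and $(f*G)(x)=\int f(x-\theta)\,dG(\theta)$. Let $p_0$ be any probability density on $\mathbb R^d$ and let $Y_1,Y_2,\dots$ be i.i.d. with density $p_0$. Let $$\widehat G_{n,\sigma}\in\operatorname*{arg\,max}_{G\in\mathcal P(\Theta)}\sum_{i=1}^n\log(\phi_\sigma*G)(Y_i)$$ be any nonparametric maximum likelihood estimator, and let $G_\sigma\in\operatorname*{arg\,min}_{G\in\mathcal P(\Theta)}\mathrm{KL}(p_0\,\|\,\phi_\sigma*G)$. Suppose that $\operatorname{supp}(G_\sigma)$ has finitely many connected components $S_{\sigma,1},\dots,S_{\sigma,N_\sigma}$, and put $$\lambda_{\sigma,k}=G_\sigma(S_{\sigma,k}),\qquad f_{\sigma,k}=\phi_\sigma*G_\sigma(\,\cdot\mid S_{\sigma,k}).$$ **Estimators.** For $\delta,t>0$ let $I_\delta=(2\delta)^{-d}\mathbf 1_{[-\delta,\delta]^d}$.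 Given (possibly random) $\delta_n,t_n>0$, apply single-linkage clustering, stopped at $N_\sigma$ clusters (ties being broken in any way), to the level set $L_n=\{\widehat G_{n,\sigma}*I_{\delta_n}>t_n\}$. That is, split $L_n$ into $N_\sigma$ nonempty sets $\widehat S_{\sigma,1},\dots,\widehat S_{\sigma,N_\sigma}$ such that for some $r>0$ any two points of the same set are joined by a finite chain in that set with steps of length at most $r$, while points of different sets are at distance at least $r$. Let $$E_k=\{x\in\Theta:\operatorname{dist}(x,\widehat S_{\sigma,k})\le\operatorname{dist}(x,\widehat S_{\sigma,j})\ \ \forall j\ne k\},\qquad \widehat\lambda_{n,\sigma,k}=\widehat G_{n,\sigma}(E_k),\qquad \widehat f_{n,\sigma,k}=\phi_\sigma*\widehat G_{n,\sigma}(\,\cdot\mid E_k).$$ **Theorem 4.1.** (i) Suppose that almost surely $\delta_n\to0$, $t_n\to0$ and, for all large $n$, $$t_n\ \ge\ 2^{-d}\,\delta_n^{-(d+1)}\,d^{-1/2}\,W_1(\widehat G_{n,\sigma},G_\sigma),\qquad(\ast)$$ where $W_1$ is the $1$-Wasserstein distance. Then almost surely, for all large $n$, such a clustering of $L_n$ exists,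 and for whichever such clustering is used, with the clusters listed in a suitable order for each $n$, $$\max_{1\le k\le N_\sigma}\Big[\,|\widehat\lambda_{n,\sigma,k}-\lambda_{\sigma,k}|\ \vee\ \|\widehat f_{n,\sigma,k}-f_{\sigma,k}\|_{L^1(\mathbb R^d)}\Big]\ \longrightarrow\ 0 .$$ (ii) If $\mathrm{KL}(p_0\,\|\,\phi_\sigma*G_\sigma)<\infty$, then all sufficiently slowly decaying deterministic sequences satisfy the requirement $(\ast)$: there are deterministic $\varepsilon_n>0$ with $\varepsilon_n\to0$ such that, for all deterministic sequences with $\delta_n\ge\varepsilon_n$ and $t_n\ge\varepsilon_n$ for all large $n$, almost surely $(\ast)$ holds for all large $n$. -/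

import Mathlib

open MeasureTheory ProbabilityTheory Filter Topology
open scoped ENNReal

noncomputable section

/-- The space `ℝ^d` with the Euclidean norm. -/
abbrev Euc (d : ℕ) : Type := EuclideanSpace ℝ (Fin d)

/-- `p₀` is a probability density on `ℝ^d` (with respect to Lebesgue measure). -/
structure IsDensity {d : ℕ} (p₀ : Euc d → ℝ) : Prop where
  measurable : Measurable p₀
  nonneg : ∀ x, 0 ≤ p₀ x
  lintegral_eq_one : ∫⁻ x, ENNReal.ofReal (p₀ x) = 1

/-- The measure on `ℝ^d` with Lebesgue density `p`. -/
def densityMeasure {d : ℕ} (p : Euc d → ℝ) : Measure (Euc d) :=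
  volume.withDensity fun x => ENNReal.ofReal (p x)

/-- `𝒫(Θ)`: the Borel probability measures on `ℝ^d` supported on `Θ`. -/
def mixingMeasures {d : ℕ} (Θ : Set (Euc d)) : Set (Measure (Euc d)) :=
  {G | IsProbabilityMeasure G ∧ G Θᶜ = 0}

/-- `φ_σ`: the density of the Gaussian `N(0, σ² I_d)`. -/
def gaussianKernel {d : ℕ} (σ : ℝ) (z : Euc d) : ℝ :=
  (2 * Real.pi * σ ^ 2) ^ (-(d : ℝ) / 2) * Real.exp (-‖z‖ ^ 2 / (2 * σ ^ 2))

/-- `I_δ = (2δ)^{-d} 1_{[-δ,δ]^d}`: the box kernel. -/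
def boxKernel {d : ℕ} (δ : ℝ) (z : Euc d) : ℝ :=
  ((2 * δ) ^ d)⁻¹ * Set.indicator {y : Euc d | ∀ i, |y i| ≤ δ} (fun _ => (1 : ℝ)) z

/-- `f * G`: the convolution of the function `f` with the measure `G`. -/
def convMeasure {d : ℕ} (f : Euc d → ℝ) (G : Measure (Euc d)) (x : Euc d) : ℝ :=
  ∫ θ, f (x - θ) ∂G

/-- `φ_σ * G`: the Gaussian mixture density with mixing measure `G`. -/
def mixDensity {d : ℕ} (σ : ℝ) (G : Measure (Euc d)) : Euc d → ℝ :=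
  convMeasure (gaussianKernel σ) G

/-- `KL(p₀ ‖ φ_σ * G)`, with values in `[0, ∞]`. -/
def klToMixture {d : ℕ} (p₀ : Euc d → ℝ) (σ : ℝ) (G : Measure (Euc d)) : ℝ≥0∞ :=
  InformationTheory.klDiv (densityMeasure p₀) (densityMeasure (mixDensity σ G))

/-- `G` is the mixing measure of a Kullback-Leibler projection of `p₀` onto the Gaussian mixtures
`φ_σ * H` with `H ∈ 𝒫(Θ)`. -/
def IsKLProjection {d : ℕ} (p₀ : Euc d → ℝ) (Θ : Set (Euc d)) (σ : ℝ) (G : Measure (Euc d)) :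
    Prop :=
  G ∈ mixingMeasures Θ ∧ ∀ H ∈ mixingMeasures Θ, klToMixture p₀ σ G ≤ klToMixture p₀ σ H

/-- `G` is a nonparametric maximum likelihood estimator computed from the `n` observations
`y 0, …, y (n - 1)`: it maximizes the log-likelihood over `𝒫(Θ)`. -/
def IsNPMLE {d : ℕ} (Θ : Set (Euc d)) (σ : ℝ) (n : ℕ) (y : ℕ → Euc d) (G : Measure (Euc d)) :
    Prop :=
  G ∈ mixingMeasures Θ ∧ ∀ H ∈ mixingMeasures Θ,
    ∑ i ∈ Finset.range n, Real.log (mixDensity σ H (y i)) ≤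
      ∑ i ∈ Finset.range n, Real.log (mixDensity σ G (y i))

/-- The `1`-Wasserstein distance: the infimum of the transport cost over all couplings. -/
def wasserstein1 {d : ℕ} (P Q : Measure (Euc d)) : ℝ≥0∞ :=
  ⨅ γ ∈ {γ : Measure (Euc d × Euc d) | γ.map Prod.fst = P ∧ γ.map Prod.snd = Q},
    ∫⁻ z, edist z.1 z.2 ∂γ

/-- The family `S` lists, without repetition, all connected components of the set `A`
(in particular `A` has exactly `N` connected components). -/
def EnumeratesComponents {d N : ℕ} (A : Set (Euc d)) (S : Fin N → Set (Euc d)) : Prop :=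
  Function.Injective S ∧ Set.range S = {C | ∃ x ∈ A, C = connectedComponentIn A x}

/-- `{x | (Ĝ * I_δ)(x) > t}`: the level set of the box-kernel smoothing of `Ĝ`. -/
def boxLevelSet {d : ℕ} (G : Measure (Euc d)) (δ t : ℝ) : Set (Euc d) :=
  {x | t < convMeasure (boxKernel δ) G x}

/-- `x` and `y` can be joined by a finite chain of points of `C` with steps of length at most
`r`. -/
def ChainLinked {d : ℕ} (C : Set (Euc d)) (r : ℝ) (x y : Euc d) : Prop :=
  Relation.ReflTransGen (fun a b => a ∈ C ∧ b ∈ C ∧ dist a b ≤ r) x y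

/-- `C` is a result of single-linkage clustering of the set `L` stopped at `N` clusters: `L` is
split into `N` nonempty clusters, and at some linkage height `r > 0` all points of a cluster are
chained together inside that cluster by steps of length at most `r`, whereas different clusters are
at distance at least `r`. (Equality is allowed in both places, so that ties between
merges at the final height may be broken in any way.) -/
structure IsSingleLinkage {d N : ℕ} (L : Set (Euc d)) (C : Fin N → Set (Euc d)) : Prop where
  nonempty : ∀ k, (C k).Nonempty
  iUnion_eq : ⋃ k, C k = L
  exists_height : ∃ r : ℝ, 0 < r ∧
    (∀ k, ∀ x ∈ C k, ∀ y ∈ C k, ChainLinked (C k) r x y) ∧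
    (∀ j k, j ≠ k → ∀ x ∈ C j, ∀ y ∈ C k, r ≤ dist x y)

/-- The `k`-th cell `E_k` of the Voronoi partition of `Θ` induced by the sets `C`. -/
def voronoiCell {d N : ℕ} (Θ : Set (Euc d)) (C : Fin N → Set (Euc d)) (k : Fin N) :
    Set (Euc d) :=
  {x ∈ Θ | ∀ j, j ≠ k → Metric.infDist x (C k) ≤ Metric.infDist x (C j)}

/-- The weight `G(A)` of the part of `G` in `A`. -/
def partWeight {d : ℕ} (G : Measure (Euc d)) (A : Set (Euc d)) : ℝ := G.real A

/-- The density `φ_σ * G(· | A)` of the part of `G` in `A`. -/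
def partDensity {d : ℕ} (σ : ℝ) (G : Measure (Euc d)) (A : Set (Euc d)) : Euc d → ℝ :=
  mixDensity σ (ProbabilityTheory.cond G A)

/-- The `L¹(ℝ^d)` distance of two functions. -/
def l1Dist {d : ℕ} (f g : Euc d → ℝ) : ℝ := ∫ x, |f x - g x|

/-- The threshold condition `t ≥ 2^{-d} δ^{-(d+1)} d^{-1/2} W` (for `δ > 0`). -/
def ThresholdCondition (d : ℕ) (δ t : ℝ) (W : ℝ≥0∞) : Prop :=
  ENNReal.ofReal (((2 : ℝ) ^ d * δ ^ (d + 1) * √(d : ℝ))⁻¹) * W ≤ ENNReal.ofReal t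

end

/-! Part (i) is pathwise. Write `w` for the Wasserstein distance of the estimator from `G`. The
threshold condition with `δ, t → 0` forces `w → 0` and makes the level set Hausdorff-close to the
support of `G`. A level point further than `2√d δ` from the support would carry mass above `t
(2δ)^d` in its cube, all of which must travel more than `√d δ`; the cost would exceed the bound on
`w` (`exists_mem_support_dist_le`). Conversely, every ball around a support point has positive
`G`-mass, which survives Wasserstein convergence, whereas a smoothing bounded by `t → 0` on a ball
leaves vanishing mass there (`eventually_exists_mem_boxLevelSet`).

Since the components of the support are connected and separated by some `ρ > 0`, a set this close to
them admits only one single-linkage clustering into `N` clusters, up to order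
(`nearPart_isSingleLinkage`). The Voronoi cells then agree with the components up to displacements
below `η = ρ / 6`. Hence functions cut off to cell and component are jointly Lipschitz on the
carriers of the two measures, and their integrals differ by `O(w)` (`abs_setIntegral_sub_le`). This
gives weights and pointwise densities; a Gaussian envelope gives `L¹`.

Part (ii) is Wasserstein consistency of the maximum likelihood estimator followed by a diagonal
argument. Finite divergence gives `p₀` a second moment, so log-likelihoods, which grow at most
quadratically, are integrable. `G` is the unique maximizer of the expected log-likelihood: strict
concavity of the logarithm forces two maximizers to have equal densities `p₀`-almost everywhere,
analyticity extends equality from a set of positive volume to all of space, and moment generating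
functions identify the mixing measure. Weak compactness of the measures on `Θ` turns uniqueness into
a gap (`IsKLProjection.exists_gap`), which a uniform law of large numbers transfers to the sample.
The exceptional events are null-measurable and serve all maximizers at once, so the estimator need
not be measurable in `ω`. Borel-Cantelli then yields a deterministic rate (`exists_slow_levels`). -/

/-! ### Single-linkage clustering of a set close to a union of separated connected sets -/

/-- If a family of `N` sets refines a partition into `N` nonempty sets of the same union, then
the two agree up to the order of the sets. -/
theorem exists_perm_eq_of_refines {α : Type*} {N : ℕ} {X Z : Fin N → Set α}
    (hZ : ∀ k, (Z k).Nonempty)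
    (hdisj : ∀ j k, j ≠ k → Disjoint (Z j) (Z k)) (hU : ⋃ k, X k = ⋃ k, Z k)
    (href : ∀ k, ∃ j, X k ⊆ Z j) : ∃ π : Equiv.Perm (Fin N), ∀ k, X k = Z (π k) := by
  choose f hf using href
  have huniq : ∀ j k z, z ∈ Z j → z ∈ Z k → j = k := fun j k z hj hk => by
    by_contra h
    exact Set.disjoint_left.1 (hdisj j k h) hj hk
  have hmem : ∀ j, ∀ z ∈ Z j, ∃ k, z ∈ X k ∧ f k = j := fun j z hz => by
    have : z ∈ ⋃ k, X k := hU ▸ Set.mem_iUnion.2 ⟨j, hz⟩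
    obtain ⟨k, hk⟩ := Set.mem_iUnion.1 this
    exact ⟨k, hk, huniq _ _ z (hf k hk) hz⟩
  -- A point of `Z j` is covered by some `X k`, which must then refine `Z j`. So the index map is
  -- onto, hence a permutation of a finite set.
  have hsurj : Function.Surjective f := fun j => by
    obtain ⟨z, hz⟩ := hZ j
    obtain ⟨k, -, hk⟩ := hmem j z hz
    exact ⟨k, hk⟩
  have hbij : Function.Bijective f := ⟨Finite.injective_iff_surjective.2 hsurj, hsurj⟩
  refine ⟨Equiv.ofBijective f hbij, fun k => Set.Subset.antisymm (hf k) fun z hz => ?_⟩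
  obtain ⟨k', hk', he⟩ := hmem _ z hz
  exact hbij.1 he ▸ hk'

/-- A step of length at most `r` cannot leave a block when distinct blocks are more than `r` apart.
-/
theorem ChainLinked.mem_of_separated {d N : ℕ} {r : ℝ} {C : Set (Euc d)}
    {Z : Fin N → Set (Euc d)} (hCZ : C ⊆ ⋃ k, Z k)
    (hsep : ∀ j k, j ≠ k → ∀ x ∈ Z j, ∀ y ∈ Z k, r < dist x y)
    {x y : Euc d} (hxy : ChainLinked C r x y) {k : Fin N} (hx : x ∈ Z k) : y ∈ Z k := by
  induction hxy with
  | refl => exact hx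
  | tail _ h ih =>
    obtain ⟨j, hj⟩ := Set.mem_iUnion.1 (hCZ h.2.1)
    by_contra hne
    refine absurd h.2.2 (not_le.2 (hsep k j ?_ _ ih _ hj))
    rintro rfl
    exact hne hj

/-- A partition into `N` clusters that are chained at height `r` and separated by more than `r` is
the only result of single-linkage clustering, up to order. -/
theorem IsSingleLinkage.exists_perm {d N : ℕ} {L : Set (Euc d)} {A C : Fin N → Set (Euc d)}
    {r : ℝ} (hr : 0 < r) (hne : ∀ k, (A k).Nonempty) (hU : ⋃ k, A k = L)
    (hchain : ∀ k, ∀ x ∈ A k, ∀ y ∈ A k, ChainLinked (A k) r x y)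
    (hsep : ∀ j k, j ≠ k → ∀ x ∈ A j, ∀ y ∈ A k, r < dist x y) (hC : IsSingleLinkage L C) :
    ∃ π : Equiv.Perm (Fin N), ∀ k, C (π k) = A k := by
  obtain ⟨s, hs, hCchain, hCsep⟩ := hC.exists_height
  have hAdisj : ∀ j k, j ≠ k → Disjoint (A j) (A k) := fun j k hjk =>
    Set.disjoint_left.2 fun z hj hk => by simpa using hr.trans (hsep j k hjk z hj z hk)
  have hCdisj : ∀ j k, j ≠ k → Disjoint (C j) (C k) := fun j k hjk =>
    Set.disjoint_left.2 fun z hj hk => by simpa using hs.trans_le (hCsep j k hjk z hj z hk)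
  have hUU : ⋃ k, A k = ⋃ k, C k := hU.trans hC.iUnion_eq.symm
  -- The partition with the smaller linkage height refines the other, since its chains cannot cross
  -- the other's gaps. In the tie `s = r` the strict separation of `A` decides.
  rcases le_or_gt s r with hsr | hrs
  · obtain ⟨π, hπ⟩ := exists_perm_eq_of_refines hne hAdisj hUU.symm fun k => by
      obtain ⟨x, hx⟩ := hC.nonempty k
      have hCk : C k ⊆ ⋃ k, A k := hUU ▸ Set.subset_iUnion C k
      obtain ⟨j, hj⟩ := Set.mem_iUnion.1 (hCk hx)
      exact ⟨j, fun y hy => (hCchain k x hx y hy).mem_of_separated hCk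
        (fun a b hab u hu v hv => hsr.trans_lt (hsep a b hab u hu v hv)) hj⟩
    exact ⟨π.symm, fun k => by simpa using hπ (π.symm k)⟩
  · obtain ⟨π, hπ⟩ := exists_perm_eq_of_refines hC.nonempty hCdisj hUU fun k => by
      obtain ⟨x, hx⟩ := hne k
      have hAk : A k ⊆ ⋃ k, C k := hUU ▸ Set.subset_iUnion A k
      obtain ⟨j, hj⟩ := Set.mem_iUnion.1 (hAk hx)
      exact ⟨j, fun y hy => (hchain k x hx y hy).mem_of_separated hAk
        (fun a b hab u hu v hv => hrs.trans_le (hCsep a b hab u hu v hv)) hj⟩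
    exact ⟨π, fun k => (hπ k).symm⟩

/-- The part of `L` within distance `η` of `S`. -/
def nearPart {d : ℕ} (L S : Set (Euc d)) (η : ℝ) : Set (Euc d) :=
  {x ∈ L | ∃ s ∈ S, dist x s < η}

section Near

variable {d N : ℕ} {L : Set (Euc d)} {S : Fin N → Set (Euc d)} {η : ℝ}

theorem nearPart_nonempty {S : Set (Euc d)} (hS : S.Nonempty)
    (hSL : ∀ s ∈ S, ∃ x ∈ L, dist x s < η) : (nearPart L S η).Nonempty := by
  obtain ⟨s, hs⟩ := hS
  obtain ⟨x, hx, hxs⟩ := hSL s hs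
  exact ⟨x, hx, s, hs, hxs⟩

theorem iUnion_nearPart (hLS : ∀ x ∈ L, ∃ k, ∃ s ∈ S k, dist x s < η) :
    ⋃ k, nearPart L (S k) η = L := by
  ext x
  simp only [Set.mem_iUnion]
  refine ⟨fun ⟨k, hk⟩ => hk.1, fun hx => ?_⟩
  obtain ⟨k, h⟩ := hLS x hx
  exact ⟨k, hx, h⟩

/-- On a preconnected set, a transitive relation that holds both ways between nearby points holds
everywhere. A step between approximants of two points of `S` less than `η` apart is shorter than `η
+ η + η`. -/
theorem chainLinked_nearPart {S : Set (Euc d)} (hη : 0 < η) (hS : IsPreconnected S)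
    (hSL : ∀ s ∈ S, ∃ x ∈ L, dist x s < η) :
    ∀ x ∈ nearPart L S η, ∀ y ∈ nearPart L S η, ChainLinked (nearPart L S η) (3 * η) x y := by
  rintro x ⟨hx, s, hs, hxs⟩ y ⟨hy, s', hs', hys⟩
  -- Quantifying over all approximants of `s` and `s'` makes the relation transitive: any
  -- approximant of the middle point can serve as the joint.
  refine hS.induction₂' (fun s s' => ∀ x ∈ L, dist x s < η → ∀ y ∈ L, dist y s' < η →
    ChainLinked (nearPart L S η) (3 * η) x y) ?_ ?_ hs hs' x hx hxs y hy hys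
  · intro s hs
    have h1 : ∀ᶠ s' in 𝓝[S] s, dist s' s < η :=
      nhdsWithin_le_nhds (Metric.ball_mem_nhds s hη)
    filter_upwards [h1, self_mem_nhdsWithin] with s' hd hs'
    have hd' : dist s s' < η := by rwa [dist_comm]
    refine ⟨fun x hx hxs y hy hys => ?_, fun x hx hxs y hy hys => ?_⟩
    · refine Relation.ReflTransGen.single ⟨⟨hx, s, hs, hxs⟩, ⟨hy, s', hs', hys⟩, ?_⟩
      linarith [dist_triangle4 x s s' y, dist_comm s' y]
    · refine Relation.ReflTransGen.single ⟨⟨hx, s', hs', hxs⟩, ⟨hy, s, hs, hys⟩, ?_⟩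
      linarith [dist_triangle4 x s' s y, dist_comm s y]
  · intro s₁ s₂ s₃ _ h₂ _ h12 h23 x hx hxs z hz hzs
    obtain ⟨y, hy, hys⟩ := hSL s₂ h₂
    exact (h12 x hx hxs y hy hys).trans (h23 y hy hys z hz hzs)

theorem nearPart_separated {ρ : ℝ} (hρ : ∀ j k, j ≠ k → ∀ x ∈ S j, ∀ y ∈ S k, ρ ≤ dist x y)
    (hηρ : 6 * η ≤ ρ) (hη : 0 < η) {j k : Fin N} (hjk : j ≠ k) :
    ∀ x ∈ nearPart L (S j) η, ∀ y ∈ nearPart L (S k) η, 3 * η < dist x y := by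
  rintro x ⟨-, s, hs, hxs⟩ y ⟨-, s', hs', hys⟩
  linarith [hρ j k hjk s hs s' hs', dist_triangle4 s x y s', dist_comm s x]

/-- Single-linkage clustering of a set close to `N` separated connected sets recovers these sets. -/
theorem nearPart_isSingleLinkage {ρ : ℝ} (hη : 0 < η) (hηρ : 6 * η ≤ ρ)
    (hne : ∀ k, (S k).Nonempty) (hconn : ∀ k, IsPreconnected (S k))
    (hρ : ∀ j k, j ≠ k → ∀ x ∈ S j, ∀ y ∈ S k, ρ ≤ dist x y)
    (hLS : ∀ x ∈ L, ∃ k, ∃ s ∈ S k, dist x s < η)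
    (hSL : ∀ k, ∀ s ∈ S k, ∃ x ∈ L, dist x s < η) :
    IsSingleLinkage L (fun k => nearPart L (S k) η) ∧
      ∀ C : Fin N → Set (Euc d), IsSingleLinkage L C →
        ∃ π : Equiv.Perm (Fin N), ∀ k, C (π k) = nearPart L (S k) η := by
  have h1 := fun k => nearPart_nonempty (hne k) (hSL k)
  have h2 := iUnion_nearPart hLS
  have h3 := fun k => chainLinked_nearPart hη (hconn k) (hSL k)
  refine ⟨⟨h1, h2, 3 * η, by positivity, h3, fun j k hjk x hx y hy =>
    (nearPart_separated hρ hηρ hη hjk x hx y hy).le⟩, fun C hC => ?_⟩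
  exact IsSingleLinkage.exists_perm (by positivity) h1 h2 h3
    (fun j k hjk => nearPart_separated hρ hηρ hη hjk) hC

/-- A point of `Θ` near the component `S k` lies in the `k`-th Voronoi cell, and in no other. -/
theorem mem_voronoiCell_nearPart_iff {ρ : ℝ} (hη : 0 < η) (hηρ : 6 * η ≤ ρ)
    (hne : ∀ k, (S k).Nonempty)
    (hρ : ∀ j k, j ≠ k → ∀ x ∈ S j, ∀ y ∈ S k, ρ ≤ dist x y)
    (hSL : ∀ k, ∀ s ∈ S k, ∃ x ∈ L, dist x s < η) {Θ : Set (Euc d)} {a b : Euc d}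
    (ha : a ∈ Θ) (hb : b ∈ ⋃ k, S k) (hab : dist a b < η) (k : Fin N) :
    a ∈ voronoiCell Θ (fun k => nearPart L (S k) η) k ↔ b ∈ S k := by
  -- The point `a` is within `2η` of its own part and at least `ρ - 2η ≥ 4η` from every other, so
  -- the Voronoi comparison is never ambiguous.
  have hclose : ∀ k, b ∈ S k → Metric.infDist a (nearPart L (S k) η) < 2 * η := fun k hbk => by
    obtain ⟨x, hx, hxb⟩ := hSL k b hbk
    refine (Metric.infDist_le_dist_of_mem (show x ∈ nearPart L (S k) η from
      ⟨hx, b, hbk, hxb⟩)).trans_lt ?_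
    linarith [dist_triangle a b x, dist_comm b x]
  have hfar : ∀ k j, b ∈ S k → k ≠ j → 4 * η ≤ Metric.infDist a (nearPart L (S j) η) := by
    intro k j hbk hkj
    refine (Metric.le_infDist (nearPart_nonempty (hne j) (hSL j))).2 ?_
    rintro x ⟨-, s, hs, hxs⟩
    linarith [hρ k j hkj b hbk s hs, dist_triangle4 b a x s, dist_comm b a]
  refine ⟨fun h => ?_, fun h => ⟨ha, fun j hj => ?_⟩⟩
  · obtain ⟨j, hj⟩ := Set.mem_iUnion.1 hb
    by_contra hk
    have hjk : j ≠ k := by rintro rfl; exact hk hj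
    linarith [h.2 j hjk, hclose j hj, hfar j k hj hjk]
  · linarith [hclose k h, hfar k j h hj.symm]

end Near

theorem voronoiCell_comp_perm {d N : ℕ} (Θ : Set (Euc d)) {A C : Fin N → Set (Euc d)}
    {π : Equiv.Perm (Fin N)} (h : ∀ k, C (π k) = A k) (k : Fin N) :
    voronoiCell Θ C (π k) = voronoiCell Θ A k := by
  ext x
  simp only [voronoiCell, Set.mem_ofPred_eq]
  refine and_congr_right fun _ => ⟨fun H j hj => ?_, fun H j hj => ?_⟩
  · simpa [h] using H (π j) (by simpa using hj)
  · obtain ⟨i, rfl⟩ := π.surjective j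
    simpa [h] using H i (by rintro rfl; exact hj rfl)

theorem measurableSet_voronoiCell {d N : ℕ} {Θ : Set (Euc d)} (hΘ : MeasurableSet Θ)
    (C : Fin N → Set (Euc d)) (k : Fin N) : MeasurableSet (voronoiCell Θ C k) := by
  have : voronoiCell Θ C k =
      Θ ∩ ⋂ j, ⋂ (_ : j ≠ k), {x | Metric.infDist x (C k) ≤ Metric.infDist x (C j)} := by
    ext x; simp [voronoiCell]
  rw [this]
  refine hΘ.inter (MeasurableSet.iInter fun j => MeasurableSet.iInter fun _ => ?_)
  exact measurableSet_le (Metric.continuous_infDist_pt _).measurable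
    (Metric.continuous_infDist_pt _).measurable

/-- Finitely many connected components of a compact set are separated by a positive distance. -/
theorem EnumeratesComponents.exists_separation {d N : ℕ} {A : Set (Euc d)} (hA : IsCompact A)
    {S : Fin N → Set (Euc d)} (hS : EnumeratesComponents A S) :
    (∀ k, (S k).Nonempty) ∧ (∀ k, IsPreconnected (S k)) ∧ (⋃ k, S k = A) ∧
      (∀ k, IsClosed (S k)) ∧
      ∃ ρ : ℝ, 0 < ρ ∧ ∀ j k, j ≠ k → ∀ x ∈ S j, ∀ y ∈ S k, ρ ≤ dist x y := by
  have hSk : ∀ k, ∃ x ∈ A, S k = connectedComponentIn A x := fun k => by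
    have : S k ∈ Set.range S := ⟨k, rfl⟩
    rwa [hS.2] at this
  have hclosed : ∀ k, IsClosed (S k) := fun k => by
    obtain ⟨x, hx, h⟩ := hSk k
    rw [h, connectedComponentIn_eq_image hx]
    exact hA.isClosed.isClosedEmbedding_subtypeVal.isClosedMap _ isClosed_connectedComponent
  have hsub : ∀ k, S k ⊆ A := fun k => by
    obtain ⟨x, hx, h⟩ := hSk k
    exact h ▸ connectedComponentIn_subset A x
  have hdisj : ∀ j k, j ≠ k → Disjoint (S j) (S k) := fun j k hjk => by
    obtain ⟨x, hx, hj⟩ := hSk j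
    obtain ⟨y, hy, hk⟩ := hSk k
    refine Set.disjoint_left.2 fun z hzj hzk => hjk (hS.1 ?_)
    rw [hj] at hzj
    rw [hk] at hzk
    rw [hj, hk, connectedComponentIn_eq hzj, connectedComponentIn_eq hzk]
  refine ⟨fun k => ?_, fun k => ?_, ?_, hclosed, ?_⟩
  · obtain ⟨x, hx, h⟩ := hSk k
    exact ⟨x, h ▸ mem_connectedComponentIn hx⟩
  · obtain ⟨x, hx, h⟩ := hSk k
    exact h ▸ isPreconnected_connectedComponentIn
  · refine Set.Subset.antisymm (Set.iUnion_subset hsub) fun x hx => ?_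
    have : connectedComponentIn A x ∈ Set.range S := hS.2 ▸ ⟨x, hx, rfl⟩
    obtain ⟨k, hk⟩ := this
    exact Set.mem_iUnion.2 ⟨k, hk ▸ mem_connectedComponentIn hx⟩
  · have : ∀ p : Fin N × Fin N, ∃ r : ℝ, 0 < r ∧ (p.1 ≠ p.2 → ∀ x ∈ S p.1, ∀ y ∈ S p.2,
        r ≤ dist x y) := fun p => by
      -- Diagonal pairs get the dummy value `1`, so that a single minimum over all pairs can be
      -- taken.
      by_cases hp : p.1 = p.2
      · exact ⟨1, one_pos, fun h => absurd hp h⟩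
      obtain ⟨r, hr, h⟩ := Metric.exists_pos_forall_lt_edist
        (hA.of_isClosed_subset (hclosed p.1) (hsub p.1)) (hclosed p.2) (hdisj _ _ hp)
      refine ⟨r, hr, fun _ x hx y hy => ?_⟩
      have := h x hx y hy
      rw [edist_nndist, ENNReal.coe_lt_coe] at this
      exact_mod_cast this.le
    choose r hr h using this
    rcases isEmpty_or_nonempty (Fin N) with hN | hN
    · exact ⟨1, one_pos, fun j => hN.elim j⟩
    · obtain ⟨p, hp⟩ := Finite.exists_min r
      exact ⟨r p, hr p, fun j k hjk x hx y hy => (hp (j, k)).trans (h (j, k) hjk x hx y hy)⟩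

/-! ### Integrals of functions under measures that are close in Wasserstein distance -/

theorem exists_coupling_lt {d : ℕ} {P Q : Measure (Euc d)} {c : ℝ≥0∞}
    (h : wasserstein1 P Q < c) :
    ∃ γ : Measure (Euc d × Euc d), γ.map Prod.fst = P ∧ γ.map Prod.snd = Q ∧
      ∫⁻ z, edist z.1 z.2 ∂γ < c := by
  rw [wasserstein1, iInf_lt_iff] at h
  obtain ⟨γ, h⟩ := h
  rw [iInf_lt_iff] at h
  obtain ⟨⟨h1, h2⟩, h3⟩ := h
  exact ⟨γ, h1, h2, h3⟩

theorem wasserstein1_le_of_coupling {d : ℕ} {P Q : Measure (Euc d)}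
    {γ : Measure (Euc d × Euc d)} (h1 : γ.map Prod.fst = P) (h2 : γ.map Prod.snd = Q) :
    wasserstein1 P Q ≤ ∫⁻ z, edist z.1 z.2 ∂γ :=
  iInf₂_le (f := fun (γ : Measure (Euc d × Euc d)) _ => ∫⁻ z, edist z.1 z.2 ∂γ) γ ⟨h1, h2⟩

/-- Integrate the pointwise inequality against a coupling of cost at most `W₁ + e` and let `e → 0`;
no optimal coupling is needed. Allowing two functions on two conull sets covers indicators of
different sets. -/
theorem integral_le_integral_add_wasserstein1 {d : ℕ} {P Q : Measure (Euc d)}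
    (hW : wasserstein1 P Q ≠ ∞) {A B : Set (Euc d)} (hA : P Aᶜ = 0) (hB : Q Bᶜ = 0)
    {f g : Euc d → ℝ} (hf : Integrable f P) (hg : Integrable g Q) {C : ℝ} (hC : 0 ≤ C)
    (h : ∀ a ∈ A, ∀ b ∈ B, f a ≤ g b + C * dist a b) :
    ∫ x, f x ∂P ≤ ∫ x, g x ∂Q + C * (wasserstein1 P Q).toReal := by
  have key : ∀ e : ℝ, 0 < e →
      ∫ x, f x ∂P ≤ ∫ x, g x ∂Q + C * ((wasserstein1 P Q).toReal + e) := by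
    intro e he
    obtain ⟨γ, h1, h2, h3⟩ := exists_coupling_lt
      (ENNReal.lt_add_right hW (ENNReal.ofReal_pos.2 he).ne')
    have hd : Integrable (fun z : Euc d × Euc d => dist z.1 z.2) γ := by
      refine ⟨(continuous_fst.dist continuous_snd).aestronglyMeasurable, ?_⟩
      rw [hasFiniteIntegral_iff_norm]
      refine lt_of_eq_of_lt (lintegral_congr fun z => ?_) (h3.trans_le le_top)
      rw [Real.norm_of_nonneg dist_nonneg, edist_dist]
    have hdle : ∫ z, dist z.1 z.2 ∂γ ≤ (wasserstein1 P Q).toReal + e := by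
      rw [integral_eq_lintegral_of_nonneg_ae (ae_of_all _ fun _ => dist_nonneg)
        hd.aestronglyMeasurable]
      have : ∫⁻ z, ENNReal.ofReal (dist z.1 z.2) ∂γ = ∫⁻ z, edist z.1 z.2 ∂γ :=
        lintegral_congr fun z => (edist_dist _ _).symm
      rw [this]
      refine (ENNReal.toReal_mono (by simp [hW]) h3.le).trans_eq ?_
      rw [ENNReal.toReal_add hW ENNReal.ofReal_ne_top, ENNReal.toReal_ofReal he.le]
    subst h1 h2
    have hf' : Integrable (fun z : Euc d × Euc d => f z.1) γ := hf.comp_measurable measurable_fst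
    have hg' : Integrable (fun z : Euc d × Euc d => g z.2) γ := hg.comp_measurable measurable_snd
    rw [integral_map measurable_fst.aemeasurable hf.aestronglyMeasurable,
      integral_map measurable_snd.aemeasurable hg.aestronglyMeasurable]
    have hAγ : ∀ᵐ z ∂γ, z.1 ∈ A := ae_of_ae_map measurable_fst.aemeasurable hA
    have hBγ : ∀ᵐ z ∂γ, z.2 ∈ B := ae_of_ae_map measurable_snd.aemeasurable hB
    calc ∫ z, f z.1 ∂γ ≤ ∫ z, (g z.2 + C * dist z.1 z.2) ∂γ := by
          refine integral_mono_ae hf' (hg'.add (hd.const_mul C)) ?_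
          filter_upwards [hAγ, hBγ] with z hz1 hz2 using h _ hz1 _ hz2
      _ = ∫ z, g z.2 ∂γ + C * ∫ z, dist z.1 z.2 ∂γ := by
          rw [integral_add hg' (hd.const_mul C), integral_const_mul]
      _ ≤ _ := by gcongr
  have hlim : Tendsto (fun e : ℝ => ∫ x, g x ∂Q + C * ((wasserstein1 P Q).toReal + e)) (𝓝[>] 0)
      (𝓝 (∫ x, g x ∂Q + C * ((wasserstein1 P Q).toReal + 0))) := by
    refine Tendsto.mono_left ?_ nhdsWithin_le_nhds
    exact Continuous.tendsto (by fun_prop) 0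
  rw [add_zero] at hlim
  exact ge_of_tendsto hlim (eventually_nhdsWithin_of_forall fun e he => key e he)

/-- Functions that are jointly Lipschitz on conull sets have close integrals. -/
theorem abs_integral_sub_le_wasserstein1 {d : ℕ} {P Q : Measure (Euc d)}
    (hW : wasserstein1 P Q ≠ ∞) {A B : Set (Euc d)} (hA : P Aᶜ = 0) (hB : Q Bᶜ = 0)
    {f g : Euc d → ℝ} (hf : Integrable f P) (hg : Integrable g Q) {C : ℝ} (hC : 0 ≤ C)
    (h : ∀ a ∈ A, ∀ b ∈ B, |f a - g b| ≤ C * dist a b) :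
    |∫ x, f x ∂P - ∫ x, g x ∂Q| ≤ C * (wasserstein1 P Q).toReal := by
  have h1 := integral_le_integral_add_wasserstein1 hW hA hB hf hg hC fun a ha b hb => by
    linarith [(abs_le.1 (h a ha b hb)).2]
  have h2 := integral_le_integral_add_wasserstein1 hW hA hB hf.neg hg.neg hC fun a ha b hb => by
    have := (abs_le.1 (h a ha b hb)).1
    simp only [Pi.neg_apply]
    linarith
  simp only [Pi.neg_apply, integral_neg] at h2
  rw [abs_le]
  constructor <;> linarith

/-! ### Gaussian mixtures with compactly supported mixing measure -/

section Gaussian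

variable {d : ℕ} {σ : ℝ}

/-- The maximal value of the Gaussian kernel. -/
noncomputable def gaussianConst (d : ℕ) (σ : ℝ) : ℝ := (2 * Real.pi * σ ^ 2) ^ (-(d : ℝ) / 2)

theorem gaussianConst_pos (hσ : 0 < σ) : 0 < gaussianConst d σ := by
  unfold gaussianConst
  have := Real.pi_pos
  positivity

theorem gaussianKernel_eq (z : Euc d) :
    gaussianKernel σ z = gaussianConst d σ * Real.exp (-‖z‖ ^ 2 / (2 * σ ^ 2)) := rfl

theorem gaussianKernel_pos (hσ : 0 < σ) (z : Euc d) : 0 < gaussianKernel σ z :=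
  mul_pos (gaussianConst_pos hσ) (Real.exp_pos _)

theorem gaussianKernel_le (hσ : 0 < σ) (z : Euc d) :
    gaussianKernel σ z ≤ gaussianConst d σ := by
  rw [gaussianKernel_eq]
  refine mul_le_of_le_one_right (gaussianConst_pos hσ).le (Real.exp_le_one_iff.2 ?_)
  rw [neg_div, neg_nonpos]
  positivity

theorem continuous_gaussianKernel : Continuous (gaussianKernel (d := d) σ) := by
  have : gaussianKernel (d := d) σ =
      fun z => gaussianConst d σ * Real.exp (-‖z‖ ^ 2 / (2 * σ ^ 2)) := rfl
  rw [this]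
  fun_prop

theorem le_gaussianKernel (hσ : 0 < σ) {R : ℝ} {x θ : Euc d} (hθ : ‖θ‖ ≤ R) :
    gaussianConst d σ * Real.exp (-(‖x‖ + R) ^ 2 / (2 * σ ^ 2)) ≤ gaussianKernel σ (x - θ) := by
  rw [gaussianKernel_eq]
  have h1 : ‖x - θ‖ ≤ ‖x‖ + R := (norm_sub_le x θ).trans (by linarith)
  have := gaussianConst_pos (d := d) hσ
  gcongr

/-- From `‖x‖² ≤ 2‖x - θ‖² + 2R²`: halving the decay rate buys an integrable envelope that is
uniform in `θ`. -/
theorem gaussianKernel_le_exp (hσ : 0 < σ) {R : ℝ} {x θ : Euc d} (hθ : ‖θ‖ ≤ R) :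
    gaussianKernel σ (x - θ) ≤
      gaussianConst d σ * Real.exp (R ^ 2 / (2 * σ ^ 2)) *
        Real.exp (-(1 / (4 * σ ^ 2)) * ‖x‖ ^ 2) := by
  rw [gaussianKernel_eq, mul_assoc, ← Real.exp_add]
  have h0 := gaussianConst_pos (d := d) hσ
  gcongr
  have h1 : ‖x‖ ≤ ‖x - θ‖ + R := by
    have := norm_add_le (x - θ) θ
    rw [sub_add_cancel] at this
    linarith
  have h2 : ‖x‖ ^ 2 ≤ 2 * ‖x - θ‖ ^ 2 + 2 * R ^ 2 := by
    nlinarith [norm_nonneg x, sq_nonneg (‖x - θ‖ - R)]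
  have h3 : R ^ 2 / (2 * σ ^ 2) + -(1 / (4 * σ ^ 2)) * ‖x‖ ^ 2 - -‖x - θ‖ ^ 2 / (2 * σ ^ 2) =
    (2 * ‖x - θ‖ ^ 2 + 2 * R ^ 2 - ‖x‖ ^ 2) / (4 * σ ^ 2) := by
    field_simp
    ring
  have h4 : 0 ≤ (2 * ‖x - θ‖ ^ 2 + 2 * R ^ 2 - ‖x‖ ^ 2) / (4 * σ ^ 2) :=
    div_nonneg (by linarith) (by positivity)
  linarith

theorem integrable_gaussian_envelope {b : ℝ} (hb : 0 < b) (C : ℝ) :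
    Integrable (fun x : Euc d => C * Real.exp (-b * ‖x‖ ^ 2)) := by
  refine Integrable.const_mul ?_ C
  have h := GaussianFourier.integrable_cexp_neg_mul_sq_norm_add (V := Euc d) (b := (b : ℂ))
    (by simpa using hb) 0 0
  refine h.norm.congr (ae_of_all _ fun x => ?_)
  simp only [Complex.norm_exp]
  congr 1
  simp [← Complex.ofReal_pow, ← Complex.ofReal_neg, ← Complex.ofReal_mul]

/-- The Gaussian kernel changes by a factor close to one when it is moved a little. -/
theorem gaussianKernel_le_mul_exp (hσ : 0 < σ) {K : ℝ} {z w : Euc d} (hz : ‖z‖ ≤ K)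
    (hw : ‖w‖ ≤ K) :
    gaussianKernel σ z ≤ gaussianKernel σ w * Real.exp (K / σ ^ 2 * dist z w) := by
  rw [gaussianKernel_eq, gaussianKernel_eq, mul_assoc, ← Real.exp_add]
  have h0 := gaussianConst_pos (d := d) hσ
  gcongr
  have h1 : ‖w‖ ≤ ‖z‖ + dist z w := by
    rw [dist_eq_norm, norm_sub_rev]
    have := norm_add_le (w - z) z
    rw [sub_add_cancel] at this
    linarith
  have h2 : ‖w‖ ^ 2 - ‖z‖ ^ 2 ≤ 2 * K * dist z w := by
    have : (‖w‖ - ‖z‖) * (‖w‖ + ‖z‖) ≤ dist z w * (2 * K) := by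
      rcases le_total ‖w‖ ‖z‖ with h | h
      · have h5 : (‖w‖ - ‖z‖) * (‖w‖ + ‖z‖) ≤ 0 :=
          mul_nonpos_of_nonpos_of_nonneg (by linarith) (by positivity)
        have : 0 ≤ K := (norm_nonneg z).trans hz
        exact h5.trans (by positivity)
      · exact mul_le_mul (by linarith) (by linarith) (by positivity) dist_nonneg
    linarith
  have h3 : -‖w‖ ^ 2 / (2 * σ ^ 2) + K / σ ^ 2 * dist z w - -‖z‖ ^ 2 / (2 * σ ^ 2) =
      (2 * K * dist z w - (‖w‖ ^ 2 - ‖z‖ ^ 2)) / (2 * σ ^ 2) := by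
    field_simp
    ring
  have h4 : 0 ≤ (2 * K * dist z w - (‖w‖ ^ 2 - ‖z‖ ^ 2)) / (2 * σ ^ 2) :=
    div_nonneg (by linarith) (by positivity)
  linarith

theorem integrable_gaussianKernel_sub (hσ : 0 < σ) (ν : Measure (Euc d)) [IsFiniteMeasure ν]
    (x : Euc d) : Integrable (fun θ => gaussianKernel σ (x - θ)) ν := by
  refine Integrable.of_bound (C := gaussianConst d σ)
    (continuous_gaussianKernel.comp (continuous_const.sub continuous_id)).aestronglyMeasurable
    (ae_of_all _ fun θ => ?_)
  rw [Real.norm_of_nonneg (gaussianKernel_pos hσ _).le]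
  exact gaussianKernel_le hσ _

theorem continuous_mixDensity (hσ : 0 < σ) (ν : Measure (Euc d)) [IsFiniteMeasure ν] :
    Continuous (mixDensity σ ν) := by
  refine continuous_of_dominated (bound := fun _ => gaussianConst d σ) (fun x =>
    (integrable_gaussianKernel_sub hσ ν x).aestronglyMeasurable) (fun x => ae_of_all _ fun θ => ?_)
    (integrable_const _) (ae_of_all _ fun θ => ?_)
  · rw [Real.norm_of_nonneg (gaussianKernel_pos hσ _).le]
    exact gaussianKernel_le hσ _
  · exact continuous_gaussianKernel.comp (continuous_id.sub continuous_const)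

theorem mixDensity_nonneg (hσ : 0 < σ) (ν : Measure (Euc d)) (x : Euc d) :
    0 ≤ mixDensity σ ν x :=
  integral_nonneg fun _ => (gaussianKernel_pos hσ _).le

variable {ν : Measure (Euc d)} [IsProbabilityMeasure ν] {R : ℝ}

theorem le_mixDensity (hσ : 0 < σ) (hν : ∀ᵐ θ ∂ν, ‖θ‖ ≤ R) (x : Euc d) :
    gaussianConst d σ * Real.exp (-(‖x‖ + R) ^ 2 / (2 * σ ^ 2)) ≤ mixDensity σ ν x := by
  have h := integral_mono_ae (μ := ν) (integrable_const _) (integrable_gaussianKernel_sub hσ ν x)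
    (hν.mono fun θ hθ => le_gaussianKernel hσ (x := x) hθ)
  simpa [mixDensity, convMeasure] using h

theorem mixDensity_le_exp (hσ : 0 < σ) (hν : ∀ᵐ θ ∂ν, ‖θ‖ ≤ R) (x : Euc d) :
    mixDensity σ ν x ≤ gaussianConst d σ * Real.exp (R ^ 2 / (2 * σ ^ 2)) *
        Real.exp (-(1 / (4 * σ ^ 2)) * ‖x‖ ^ 2) := by
  have h := integral_mono_ae (μ := ν) (integrable_gaussianKernel_sub hσ ν x) (integrable_const _)
    (hν.mono fun θ hθ => gaussianKernel_le_exp hσ (x := x) hθ)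
  simpa [mixDensity, convMeasure] using h

theorem mixDensity_le (hσ : 0 < σ) (x : Euc d) : mixDensity σ ν x ≤ gaussianConst d σ := by
  have h := integral_mono (μ := ν) (integrable_gaussianKernel_sub hσ ν x) (integrable_const _)
    (fun θ => gaussianKernel_le hσ (x - θ))
  simpa [mixDensity, convMeasure] using h

theorem mixDensity_pos (hσ : 0 < σ) (hν : ∀ᵐ θ ∂ν, ‖θ‖ ≤ R) (x : Euc d) :
    0 < mixDensity σ ν x :=
  (mul_pos (gaussianConst_pos hσ) (Real.exp_pos _)).trans_le (le_mixDensity hσ hν x)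

/-- The comparison of kernels is multiplicative with a factor free of `θ`, so it survives
integration over the mixing measure. -/
theorem mixDensity_le_mul_exp (hσ : 0 < σ) (hν : ∀ᵐ θ ∂ν, ‖θ‖ ≤ R) {K : ℝ} {x y : Euc d}
    (hx : ‖x‖ ≤ K) (hy : ‖y‖ ≤ K) :
    mixDensity σ ν x ≤ mixDensity σ ν y * Real.exp ((K + R) / σ ^ 2 * dist x y) := by
  have h : ∫ θ, gaussianKernel σ (x - θ) ∂ν ≤
      ∫ θ, gaussianKernel σ (y - θ) * Real.exp ((K + R) / σ ^ 2 * dist x y) ∂ν := by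
    refine integral_mono_ae (integrable_gaussianKernel_sub hσ ν x)
      ((integrable_gaussianKernel_sub hσ ν y).mul_const _) (hν.mono fun θ hθ => ?_)
    have := gaussianKernel_le_mul_exp hσ (z := x - θ) (w := y - θ) (K := K + R)
      ((norm_sub_le _ _).trans (by linarith)) ((norm_sub_le _ _).trans (by linarith))
    rwa [dist_sub_right] at this
  rwa [integral_mul_const] at h

/-- The Lipschitz constant on a ball does not depend on the mixing measure; this equicontinuity is
what produces finite nets later. -/
theorem abs_log_mixDensity_sub_le (hσ : 0 < σ) (hν : ∀ᵐ θ ∂ν, ‖θ‖ ≤ R) {K : ℝ} {x y : Euc d}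
    (hx : ‖x‖ ≤ K) (hy : ‖y‖ ≤ K) :
    |Real.log (mixDensity σ ν x) - Real.log (mixDensity σ ν y)| ≤
      (K + R) / σ ^ 2 * dist x y := by
  have key : ∀ {x y : Euc d}, ‖x‖ ≤ K → ‖y‖ ≤ K →
      Real.log (mixDensity σ ν x) ≤ Real.log (mixDensity σ ν y) + (K + R) / σ ^ 2 * dist x y := by
    intro x y hx hy
    rw [← Real.log_exp ((K + R) / σ ^ 2 * dist x y),
      ← Real.log_mul (mixDensity_pos hσ hν y).ne' (Real.exp_pos _).ne']
    exact Real.log_le_log (mixDensity_pos hσ hν x) (mixDensity_le_mul_exp hσ hν hx hy)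
  rw [abs_le]
  have h1 := key hx hy
  have h2 := key hy hx
  rw [dist_comm] at h2
  constructor <;> linarith

/-- The log-density of a Gaussian mixture grows at most quadratically. -/
theorem abs_log_mixDensity_le (hσ : 0 < σ) (hν : ∀ᵐ θ ∂ν, ‖θ‖ ≤ R) (x : Euc d) :
    |Real.log (mixDensity σ ν x)| ≤ |Real.log (gaussianConst d σ)| + R ^ 2 / σ ^ 2
      + 1 / σ ^ 2 * ‖x‖ ^ 2 := by
  have h0 := gaussianConst_pos (d := d) hσ
  have h1 : Real.log (mixDensity σ ν x) ≤ Real.log (gaussianConst d σ) :=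
    Real.log_le_log (mixDensity_pos hσ hν x) (mixDensity_le hσ x)
  have h2 : Real.log (gaussianConst d σ) + -(‖x‖ + R) ^ 2 / (2 * σ ^ 2) ≤
      Real.log (mixDensity σ ν x) := by
    rw [← Real.log_exp (-(‖x‖ + R) ^ 2 / (2 * σ ^ 2)),
      ← Real.log_mul h0.ne' (Real.exp_pos _).ne']
    exact Real.log_le_log (mul_pos h0 (Real.exp_pos _)) (le_mixDensity hσ hν x)
  have h3 : (‖x‖ + R) ^ 2 / (2 * σ ^ 2) ≤ R ^ 2 / σ ^ 2 + 1 / σ ^ 2 * ‖x‖ ^ 2 := by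
    have : R ^ 2 / σ ^ 2 + 1 / σ ^ 2 * ‖x‖ ^ 2 - (‖x‖ + R) ^ 2 / (2 * σ ^ 2) =
        (‖x‖ - R) ^ 2 / (2 * σ ^ 2) := by
      field_simp
      ring
    have h4 : 0 ≤ (‖x‖ - R) ^ 2 / (2 * σ ^ 2) := by positivity
    linarith
  have h5 : 0 ≤ (‖x‖ + R) ^ 2 / (2 * σ ^ 2) := by positivity
  have h6 := le_abs_self (Real.log (gaussianConst d σ))
  have h7 := neg_abs_le (Real.log (gaussianConst d σ))
  rw [neg_div] at h2
  rw [abs_le]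
  constructor <;> linarith

end Gaussian

/-! ### Level sets of box-kernel smoothings -/

section Box

variable {d : ℕ}

/-- The closed cube `[-δ, δ]^d`. -/
def cube (d : ℕ) (δ : ℝ) : Set (Euc d) := {y | ∀ i, |y i| ≤ δ}

theorem measurableSet_cube (δ : ℝ) : MeasurableSet (cube d δ) := by
  have : cube d δ = ⋂ i, {y : Euc d | |y i| ≤ δ} := by ext; simp [cube]
  rw [this]
  exact (isClosed_iInter fun i => isClosed_le (by fun_prop) continuous_const).measurableSet

theorem norm_le_of_mem_cube {δ : ℝ} {y : Euc d} (hδ : 0 ≤ δ) (hy : y ∈ cube d δ) :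
    ‖y‖ ≤ √d * δ := by
  rw [EuclideanSpace.norm_eq, ← Real.sqrt_sq hδ, ← Real.sqrt_mul (Nat.cast_nonneg d)]
  refine Real.sqrt_le_sqrt ?_
  calc ∑ i, ‖y i‖ ^ 2 ≤ ∑ _i : Fin d, δ ^ 2 :=
        Finset.sum_le_sum fun i _ => pow_le_pow_left₀ (norm_nonneg _) (hy i) 2
    _ = d * δ ^ 2 := by simp

theorem volume_cube {δ : ℝ} (hδ : 0 ≤ δ) : volume (cube d δ) = ENNReal.ofReal ((2 * δ) ^ d) := by
  have h : cube d δ = (MeasurableEquiv.toLp 2 (Fin d → ℝ)).symm ⁻¹'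
      (Set.Icc (fun _ => -δ) (fun _ => δ)) := by
    ext y
    simp [cube, abs_le, Pi.le_def, forall_and]
  rw [h, (EuclideanSpace.volume_preserving_symm_measurableEquiv_toLp (Fin d)).measure_preimage
    measurableSet_Icc.nullMeasurableSet, Real.volume_Icc_pi]
  simp only [Finset.prod_const, Finset.card_univ, Fintype.card_fin]
  rw [← ENNReal.ofReal_pow (by linarith)]
  congr 2
  ring

theorem boxKernel_eq (δ : ℝ) (z : Euc d) :
    boxKernel δ z = (cube d δ).indicator (fun _ => ((2 * δ) ^ d)⁻¹) z := by
  unfold boxKernel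
  change _ * (cube d δ).indicator _ z = _
  by_cases h : z ∈ cube d δ <;> simp [h]

theorem measurable_boxKernel (δ : ℝ) : Measurable (boxKernel (d := d) δ) := by
  have : boxKernel (d := d) δ = (cube d δ).indicator (fun _ => ((2 * δ) ^ d)⁻¹) :=
    funext (boxKernel_eq δ)
  rw [this]
  exact measurable_const.indicator (measurableSet_cube δ)

theorem boxKernel_nonneg {δ : ℝ} (hδ : 0 ≤ δ) (z : Euc d) : 0 ≤ boxKernel δ z := by
  rw [boxKernel_eq]
  exact Set.indicator_nonneg (fun _ _ => by positivity) z

theorem boxKernel_le {δ : ℝ} (hδ : 0 ≤ δ) (z : Euc d) : boxKernel δ z ≤ ((2 * δ) ^ d)⁻¹ := by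
  rw [boxKernel_eq]
  exact Set.indicator_le_self' (fun _ _ => by positivity) z

theorem lintegral_boxKernel {δ : ℝ} (hδ : 0 < δ) :
    ∫⁻ z : Euc d, ENNReal.ofReal (boxKernel δ z) = 1 := by
  have : ∀ z : Euc d, ENNReal.ofReal (boxKernel δ z) =
      (cube d δ).indicator (fun _ => ENNReal.ofReal ((2 * δ) ^ d)⁻¹) z := fun z => by
    rw [boxKernel_eq]
    by_cases h : z ∈ cube d δ <;> simp [h]
  simp_rw [this]
  rw [lintegral_indicator_const (measurableSet_cube δ), volume_cube hδ.le,
    ← ENNReal.ofReal_mul (by positivity), inv_mul_cancel₀ (by positivity), ENNReal.ofReal_one]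

theorem integrable_boxKernel_sub {δ : ℝ} (hδ : 0 ≤ δ) (H : Measure (Euc d)) [IsFiniteMeasure H]
    (x : Euc d) : Integrable (fun θ => boxKernel δ (x - θ)) H := by
  refine Integrable.of_bound (C := ((2 * δ) ^ d)⁻¹)
    ((measurable_boxKernel δ).comp (measurable_const.sub measurable_id)).aestronglyMeasurable
    (ae_of_all _ fun θ => ?_)
  rw [Real.norm_of_nonneg (boxKernel_nonneg hδ _)]
  exact boxKernel_le hδ _

theorem convMeasure_boxKernel (δ : ℝ) (H : Measure (Euc d)) (x : Euc d) :
    convMeasure (boxKernel δ) H x = ((2 * δ) ^ d)⁻¹ * H.real {θ | x - θ ∈ cube d δ} := by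
  have h : ∀ θ, boxKernel δ (x - θ) =
      {θ | x - θ ∈ cube d δ}.indicator (fun _ => ((2 * δ) ^ d)⁻¹) θ := fun θ => by
    rw [boxKernel_eq]; rfl
  have hm : MeasurableSet {θ | x - θ ∈ cube d δ} :=
    (measurable_const.sub measurable_id) (measurableSet_cube δ)
  simp_rw [convMeasure, h]
  rw [integral_indicator_const _ hm, smul_eq_mul, mul_comm]

/-- The level set lies close to the support of a measure that is near in Wasserstein distance. -/
theorem exists_mem_support_dist_le (hd : 0 < d) {H G : Measure (Euc d)} [IsProbabilityMeasure H]
    [IsProbabilityMeasure G] {δ t : ℝ} (hδ : 0 < δ) (hW : wasserstein1 H G ≠ ∞)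
    (ht : (wasserstein1 H G).toReal ≤ t * (2 ^ d * δ ^ (d + 1) * √d)) {x : Euc d}
    (hx : x ∈ boxLevelSet H δ t) : ∃ s ∈ G.support, dist x s ≤ 2 * (√d * δ) := by
  by_contra! hfar
  have hd' : 0 < √(d : ℝ) := Real.sqrt_pos.2 (Nat.cast_pos.2 hd)
  have hx' : t < convMeasure (boxKernel δ) H x := hx
  rw [convMeasure_boxKernel] at hx'
  set U := {θ | x - θ ∈ cube d δ} with hU
  have hm : MeasurableSet U := (measurable_const.sub measurable_id) (measurableSet_cube δ)
  -- The cube indicator and the zero function are compared with Lipschitz constant `(√d δ)⁻¹`: a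
  -- point of the cube is within `√d δ` of `x`, hence at least `√d δ` from the support.
  have h := integral_le_integral_add_wasserstein1 hW (A := Set.univ) (B := G.support) (by simp)
    Measure.measure_compl_support (f := U.indicator 1) (g := 0) (C := (√d * δ)⁻¹)
    ((integrable_const (1 : ℝ)).indicator hm) (integrable_zero _ _ _)
    (by positivity) (fun a _ b hb => by
      by_cases ha : a ∈ U
      · have h1 : dist x a ≤ √d * δ := by
          rw [dist_eq_norm]; exact norm_le_of_mem_cube hδ.le ha
        have h2 : √d * δ ≤ dist a b := by linarith [hfar b hb, dist_triangle x a b]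
        simp only [Set.indicator_of_mem ha, Pi.one_apply, Pi.zero_apply, zero_add]
        rw [inv_mul_eq_div, one_le_div (by positivity)]
        exact h2
      · simp only [Set.indicator_of_notMem ha, Pi.zero_apply, zero_add]
        positivity)
  rw [integral_indicator_one hm] at h
  simp only [Pi.zero_apply, integral_zero, zero_add] at h
  have h3 : H.real U ≤ t * (2 * δ) ^ d := by
    refine h.trans ?_
    rw [inv_mul_le_iff₀ (by positivity)]
    refine ht.trans_eq ?_
    rw [mul_pow]
    ring
  have h4 : ((2 * δ) ^ d)⁻¹ * H.real U ≤ t := by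
    rw [inv_mul_le_iff₀ (by positivity)]
    linarith
  linarith

/-- If the smoothed measure is small on a ball, then the measure of a smaller ball is small. -/
theorem measure_ball_le_of_convMeasure_le (H : Measure (Euc d)) [IsProbabilityMeasure H]
    {δ t r r' : ℝ} (hδ : 0 < δ) (hr : r + √d * δ ≤ r') {s : Euc d}
    (h : ∀ x ∈ Metric.ball s r', convMeasure (boxKernel δ) H x ≤ t) :
    H (Metric.ball s r) ≤ ENNReal.ofReal t * volume (Metric.ball s r') := by
  have hmeas : Measurable fun z : Euc d × Euc d => ENNReal.ofReal (boxKernel δ (z.1 - z.2)) :=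
    ((measurable_boxKernel δ).comp (measurable_fst.sub measurable_snd)).ennreal_ofReal
  -- The box kernel centred at a point of the smaller ball has total mass one and, reaching at most
  -- `√d δ`, lives inside the larger ball.
  have hone : ∀ θ ∈ Metric.ball s r,
      1 ≤ ∫⁻ x in Metric.ball s r', ENNReal.ofReal (boxKernel δ (x - θ)) := fun θ hθ => by
    rw [← lintegral_boxKernel (d := d) hδ, ← lintegral_sub_right_eq_self _ θ,
      ← lintegral_indicator Metric.isOpen_ball.measurableSet]
    refine lintegral_mono fun x => ?_
    by_cases hx : x ∈ Metric.ball s r'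
    · simp [hx]
    · have : x - θ ∉ cube d δ := fun hc => hx <| by
        have h1 := norm_le_of_mem_cube hδ.le hc
        rw [← dist_eq_norm] at h1
        rw [Metric.mem_ball] at hθ ⊢
        linarith [dist_triangle x θ s]
      rw [boxKernel_eq, Set.indicator_of_notMem this]
      simp
  calc H (Metric.ball s r) = ∫⁻ _ in Metric.ball s r, 1 ∂H := by simp
    _ ≤ ∫⁻ θ in Metric.ball s r,
          (∫⁻ x in Metric.ball s r', ENNReal.ofReal (boxKernel δ (x - θ))) ∂H :=
        setLIntegral_mono' Metric.isOpen_ball.measurableSet hone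
    _ ≤ ∫⁻ θ, (∫⁻ x in Metric.ball s r', ENNReal.ofReal (boxKernel δ (x - θ))) ∂H :=
        setLIntegral_le_lintegral _ _
    _ = ∫⁻ x in Metric.ball s r', ∫⁻ θ, ENNReal.ofReal (boxKernel δ (x - θ)) ∂H :=
        lintegral_lintegral_swap (f := fun θ x => ENNReal.ofReal (boxKernel δ (x - θ)))
          (hmeas.comp measurable_swap).aemeasurable
    _ = ∫⁻ x in Metric.ball s r', ENNReal.ofReal (convMeasure (boxKernel δ) H x) := by
        refine lintegral_congr fun x => ?_
        rw [convMeasure, ofReal_integral_eq_lintegral_ofReal (integrable_boxKernel_sub hδ.le H x)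
          (ae_of_all _ fun _ => boxKernel_nonneg hδ.le _)]
    _ ≤ ∫⁻ _ in Metric.ball s r', ENNReal.ofReal t :=
        setLIntegral_mono' Metric.isOpen_ball.measurableSet
          fun x hx => ENNReal.ofReal_le_ofReal (h x hx)
    _ = ENNReal.ofReal t * volume (Metric.ball s r') := by simp

/-- Eventually the level sets meet every ball around a point of the support of the limit. -/
theorem eventually_exists_mem_boxLevelSet {H : ℕ → Measure (Euc d)} {G : Measure (Euc d)}
    [IsProbabilityMeasure G] (hH : ∀ n, IsProbabilityMeasure (H n)) {δ t : ℕ → ℝ}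
    (hδ : ∀ᶠ n in atTop, 0 < δ n) (hδ0 : Tendsto δ atTop (𝓝 0)) (ht0 : Tendsto t atTop (𝓝 0))
    (hW : ∀ᶠ n in atTop, wasserstein1 (H n) G ≠ ∞)
    (hw : Tendsto (fun n => (wasserstein1 (H n) G).toReal) atTop (𝓝 0)) {s : Euc d}
    (hs : s ∈ G.support) {η : ℝ} (hη : 0 < η) :
    ∀ᶠ n in atTop, ∃ x ∈ boxLevelSet (H n) (δ n) (t n), dist x s < η := by
  have hm : 0 < G.real (Metric.ball s (η / 4)) :=
    ENNReal.toReal_pos ((Measure.mem_support_iff_forall s).1 hs _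
      (Metric.ball_mem_nhds s (by positivity))).ne' (measure_ne_top _ _)
  set m := G.real (Metric.ball s (η / 4)) with hm_def
  have e1 : ∀ᶠ n in atTop, √d * δ n < η / 2 := by
    have : Tendsto (fun n => √d * δ n) atTop (𝓝 (√d * 0)) := hδ0.const_mul _
    rw [mul_zero] at this
    exact this.eventually_lt_const (by positivity)
  have e2 : ∀ᶠ n in atTop, (4 / η) * (wasserstein1 (H n) G).toReal < m / 2 := by
    have := hw.const_mul (4 / η)
    rw [mul_zero] at this
    exact this.eventually_lt_const (by positivity)
  have e3 : ∀ᶠ n in atTop, ENNReal.ofReal (t n) * volume (Metric.ball s η) <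
      ENNReal.ofReal (m / 2) := by
    have h1 : Tendsto (fun n => ENNReal.ofReal (t n)) atTop (𝓝 0) := by
      simpa using ENNReal.tendsto_ofReal ht0
    have := ENNReal.Tendsto.mul_const (b := volume (Metric.ball s η)) h1
      (Or.inr measure_ball_lt_top.ne)
    rw [zero_mul] at this
    exact this.eventually_lt_const (by simpa using hm)
  filter_upwards [hδ, hW, e1, e2, e3] with n hδn hWn h1 h2 h3
  have := hH n
  by_contra! hcon
  have h4 : H n (Metric.ball s (η / 2)) ≤ ENNReal.ofReal (t n) * volume (Metric.ball s η) := by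
    refine measure_ball_le_of_convMeasure_le (H n) hδn (by linarith) fun x hx => ?_
    by_contra! hlt
    exact absurd (Metric.mem_ball.1 hx) (not_lt.2 (hcon x hlt))
  have h5 : (H n).real (Metric.ball s (η / 2)) < m / 2 :=
    (ENNReal.toReal_lt_of_lt_ofReal (h4.trans_lt h3))
  -- Mass of `G` in the ball of radius `η / 4` not matched inside radius `η / 2` must travel at
  -- least `η / 4`, so `m ≤ H(ball) + (4 / η) W₁ < m / 2 + m / 2`. The signs are negated because the
  -- lemma bounds its first measure from above.
  have h6 := integral_le_integral_add_wasserstein1 hWn (A := Set.univ) (B := Set.univ) (by simp)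
    (by simp) (f := fun x => -(Metric.ball s (η / 2)).indicator (1 : Euc d → ℝ) x)
    (g := fun x => -(Metric.ball s (η / 4)).indicator (1 : Euc d → ℝ) x)
    (C := 4 / η) ((integrable_const (1 : ℝ)).indicator measurableSet_ball).neg
    ((integrable_const (1 : ℝ)).indicator measurableSet_ball).neg (by positivity)
    (fun a _ b _ => by
      by_cases hb : b ∈ Metric.ball s (η / 4)
      · by_cases ha : a ∈ Metric.ball s (η / 2)
        · simp only [Set.indicator_of_mem ha, Set.indicator_of_mem hb, Pi.one_apply]
          linarith [mul_nonneg (show 0 ≤ 4 / η by positivity) (dist_nonneg (x := a) (y := b))]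
        · simp only [Set.indicator_of_notMem ha, Set.indicator_of_mem hb, Pi.one_apply]
          rw [Metric.mem_ball] at ha hb
          have : η / 4 ≤ dist a b := by linarith [dist_triangle a b s]
          have : 1 ≤ 4 / η * dist a b := by
            rw [div_mul_eq_mul_div, one_le_div hη]
            linarith
          linarith
      · simp only [Set.indicator_of_notMem hb]
        have h7 : 0 ≤ (Metric.ball s (η / 2)).indicator (1 : Euc d → ℝ) a :=
          Set.indicator_nonneg (fun _ _ => zero_le_one) a
        linarith [mul_nonneg (show 0 ≤ 4 / η by positivity) (dist_nonneg (x := a) (y := b))])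
  rw [integral_neg, integral_neg, integral_indicator_one measurableSet_ball,
    integral_indicator_one measurableSet_ball] at h6
  linarith

/-- Eventually the level sets come close to all points of the compact support of the limit. -/
theorem eventually_forall_exists_mem_boxLevelSet {H : ℕ → Measure (Euc d)} {G : Measure (Euc d)}
    [IsProbabilityMeasure G] (hG : IsCompact G.support)
    (hH : ∀ n, IsProbabilityMeasure (H n)) {δ t : ℕ → ℝ}
    (hδ : ∀ᶠ n in atTop, 0 < δ n) (hδ0 : Tendsto δ atTop (𝓝 0)) (ht0 : Tendsto t atTop (𝓝 0))
    (hW : ∀ᶠ n in atTop, wasserstein1 (H n) G ≠ ∞)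
    (hw : Tendsto (fun n => (wasserstein1 (H n) G).toReal) atTop (𝓝 0)) {η : ℝ} (hη : 0 < η) :
    ∀ᶠ n in atTop, ∀ s ∈ G.support, ∃ x ∈ boxLevelSet (H n) (δ n) (t n), dist x s < η := by
  -- A finite `η / 2`-net of the support makes the pointwise statement uniform.
  obtain ⟨T, hT, hTf, hcov⟩ := hG.finite_cover_balls (half_pos hη)
  have := (Filter.eventually_all_finite hTf).2 fun s hs =>
    eventually_exists_mem_boxLevelSet hH hδ hδ0 ht0 hW hw (hT hs) (half_pos hη)
  filter_upwards [this] with n hn s hs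
  obtain ⟨s', hs', hss'⟩ := Set.mem_iUnion₂.1 (hcov hs)
  obtain ⟨x, hx, hxs⟩ := hn s' hs'
  rw [Metric.mem_ball] at hss'
  exact ⟨x, hx, by linarith [dist_triangle x s' s, dist_comm s s']⟩

end Box

/-! ### Convergence of the parts of a mixture -/

section Parts

variable {d : ℕ}

theorem mixingMeasures_ae_norm_le {Θ : Set (Euc d)} {R : ℝ} (hR : ∀ θ ∈ Θ, ‖θ‖ ≤ R)
    {H : Measure (Euc d)} (hH : H ∈ mixingMeasures Θ) : ∀ᵐ θ ∂H, ‖θ‖ ≤ R := by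
  have h : ∀ᵐ θ ∂H, θ ∈ Θ := hH.2
  exact h.mono hR

/-- If the sets `E` and `S` agree up to displacements smaller than `η`, then integrals over them
are close. -/
theorem abs_setIntegral_sub_le {P Q : Measure (Euc d)} [IsProbabilityMeasure P]
    [IsProbabilityMeasure Q] (hW : wasserstein1 P Q ≠ ∞) {A B E S : Set (Euc d)}
    (hA : P Aᶜ = 0) (hB : Q Bᶜ = 0) (hE : MeasurableSet E) (hS : MeasurableSet S) {η : ℝ}
    (hη : 0 < η) (hES : ∀ a ∈ A, ∀ b ∈ B, dist a b < η → (a ∈ E ↔ b ∈ S)) {g : Euc d → ℝ}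
    (hg : Continuous g) {M C : ℝ} (hM : ∀ x, |g x| ≤ M) (hC : 0 ≤ C)
    (hLip : ∀ a ∈ A, ∀ b ∈ B, |g a - g b| ≤ C * dist a b) :
    |∫ x in E, g x ∂P - ∫ x in S, g x ∂Q| ≤ (C + M / η) * (wasserstein1 P Q).toReal := by
  have hM0 : 0 ≤ M := (abs_nonneg _).trans (hM 0)
  have hint : ∀ (ν : Measure (Euc d)) [IsProbabilityMeasure ν], Integrable g ν := fun ν _ =>
    Integrable.of_bound hg.aestronglyMeasurable (C := M) (ae_of_all _ hM)
  rw [← integral_indicator hE, ← integral_indicator hS]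
  refine abs_integral_sub_le_wasserstein1 hW hA hB ((hint P).indicator hE)
    ((hint Q).indicator hS) (by positivity) fun a ha b hb => ?_
  have hd : 0 ≤ dist a b := dist_nonneg
  have h1 : 0 ≤ C * dist a b := by positivity
  have h2 : 0 ≤ M / η * dist a b := by positivity
  rw [add_mul]
  -- Pairs closer than `η` lie in both sets or in neither, so only the Lipschitz bound matters. For
  -- the others a jump of at most `M` is paid for by `M / η * dist a b ≥ M`.
  by_cases hab : dist a b < η
  · have h := hES a ha b hb hab
    by_cases haE : a ∈ E
    · rw [Set.indicator_of_mem haE, Set.indicator_of_mem (h.1 haE)]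
      linarith [hLip a ha b hb]
    · rw [Set.indicator_of_notMem haE, Set.indicator_of_notMem (fun hbS => haE (h.2 hbS))]
      simp only [sub_self, abs_zero]
      linarith
  · have h3 : M ≤ M / η * dist a b := by
      rw [div_mul_eq_mul_div, le_div_iff₀ hη]
      exact mul_le_mul_of_nonneg_left (not_lt.1 hab) hM0
    by_cases haE : a ∈ E <;> by_cases hbS : b ∈ S <;>
      simp only [haE, hbS, Set.indicator_of_mem, Set.indicator_of_notMem, not_false_eq_true,
        sub_zero, zero_sub, abs_neg, sub_self, abs_zero]
    · linarith [hLip a ha b hb]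
    · linarith [hM a]
    · linarith [hM b]
    · linarith

/-- Linearization of the multiplicative estimate: `k(a) - k(b) ≤ k(a) (1 - exp (-u)) ≤ k(a) u`, with
`k(a)` at most the peak value. -/
theorem abs_gaussianKernel_sub_le {σ R : ℝ} (hσ : 0 < σ) (x : Euc d) {a b : Euc d} (ha : ‖a‖ ≤ R)
    (hb : ‖b‖ ≤ R) :
    |gaussianKernel σ (x - a) - gaussianKernel σ (x - b)| ≤
      gaussianConst d σ * ((‖x‖ + R) / σ ^ 2) * dist a b := by
  have key : ∀ {a b : Euc d}, ‖a‖ ≤ R → ‖b‖ ≤ R →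
      gaussianKernel σ (x - a) ≤ gaussianKernel σ (x - b) +
        gaussianConst d σ * ((‖x‖ + R) / σ ^ 2) * dist a b := fun {a b} ha hb => by
    have h1 := gaussianKernel_le_mul_exp hσ (z := x - a) (w := x - b) (K := ‖x‖ + R)
      ((norm_sub_le _ _).trans (by linarith)) ((norm_sub_le _ _).trans (by linarith))
    rw [dist_sub_left] at h1
    set u := (‖x‖ + R) / σ ^ 2 * dist a b with hu
    have h2 : gaussianKernel σ (x - a) * Real.exp (-u) ≤ gaussianKernel σ (x - b) := by
      rw [Real.exp_neg, ← div_eq_mul_inv, div_le_iff₀ (Real.exp_pos _)]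
      exact h1
    have h3 : 1 - u ≤ Real.exp (-u) := by linarith [Real.add_one_le_exp (-u)]
    have h4 := mul_le_mul_of_nonneg_left h3 (gaussianKernel_pos hσ (x - a)).le
    have hu0 : 0 ≤ u := by
      have : 0 ≤ R := (norm_nonneg a).trans ha
      positivity
    have h5 := mul_le_mul_of_nonneg_right (gaussianKernel_le hσ (x - a)) hu0
    rw [mul_assoc, ← hu]
    linarith
  rw [abs_le]
  have h1 := key ha hb
  have h2 := key hb ha
  rw [dist_comm] at h2
  constructor <;> linarith

theorem partDensity_eq {σ : ℝ} {H : Measure (Euc d)} {E : Set (Euc d)} (x : Euc d) :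
    partDensity σ H E x = (H.real E)⁻¹ * ∫ θ in E, gaussianKernel σ (x - θ) ∂H := by
  simp [partDensity, mixDensity, convMeasure, ProbabilityTheory.cond, integral_smul_measure,
    Measure.real]

variable {Θ : Set (Euc d)} {σ R : ℝ}

theorem partDensity_le (hσ : 0 < σ) (hR : ∀ θ ∈ Θ, ‖θ‖ ≤ R) {H : Measure (Euc d)}
    (hH : H ∈ mixingMeasures Θ) {E : Set (Euc d)} (hE : H E ≠ 0) (x : Euc d) :
    partDensity σ H E x ≤ gaussianConst d σ * Real.exp (R ^ 2 / (2 * σ ^ 2)) *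
        Real.exp (-(1 / (4 * σ ^ 2)) * ‖x‖ ^ 2) := by
  have := hH.1
  have := cond_isProbabilityMeasure hE
  exact mixDensity_le_exp hσ ((cond_absolutelyContinuous (μ := H) (s := E)).ae_le
    (mixingMeasures_ae_norm_le hR hH)) x

theorem measurable_partDensity (hσ : 0 < σ) {H : Measure (Euc d)} [IsProbabilityMeasure H]
    {E : Set (Euc d)} (hE : H E ≠ 0) : Measurable (partDensity σ H E) := by
  have := cond_isProbabilityMeasure hE
  exact (continuous_mixDensity hσ _).measurable

/-- Weights and unnormalized Gaussian integrals converge because `E n` and `S` match up to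
displacements below `η`. Dividing by a weight bounded away from zero gives pointwise convergence of
the densities, and the common Gaussian envelope gives `L¹` by dominated convergence. -/
theorem tendsto_parts (hσ : 0 < σ) (hR : ∀ θ ∈ Θ, ‖θ‖ ≤ R) {H : ℕ → Measure (Euc d)}
    {G : Measure (Euc d)} (hH : ∀ n, H n ∈ mixingMeasures Θ) (hG : G ∈ mixingMeasures Θ)
    (hW : ∀ᶠ n in atTop, wasserstein1 (H n) G ≠ ∞)
    (hw : Tendsto (fun n => (wasserstein1 (H n) G).toReal) atTop (𝓝 0)) {B S : Set (Euc d)}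
    (hB : G Bᶜ = 0) (hS : MeasurableSet S) (hGS : G S ≠ 0) {E : ℕ → Set (Euc d)}
    (hE : ∀ᶠ n in atTop, MeasurableSet (E n)) {η : ℝ} (hη : 0 < η)
    (hES : ∀ᶠ n in atTop, ∀ a ∈ Θ, ∀ b ∈ B, dist a b < η → (a ∈ E n ↔ b ∈ S)) :
    Tendsto (fun n => max |partWeight (H n) (E n) - partWeight G S|
      (l1Dist (partDensity σ (H n) (E n)) (partDensity σ G S))) atTop (𝓝 0) := by
  have hHp := fun n => (hH n).1
  have hGp := hG.1
  have key : ∀ (g : Euc d → ℝ), Continuous g → ∀ M C : ℝ, (∀ x, |g x| ≤ M) → 0 ≤ C →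
      (∀ a ∈ Θ, ∀ b ∈ Θ, |g a - g b| ≤ C * dist a b) →
      Tendsto (fun n => ∫ x in E n, g x ∂(H n)) atTop (𝓝 (∫ x in S, g x ∂G)) := by
    intro g hg M C hM hC hLip
    rw [tendsto_iff_dist_tendsto_zero]
    have hlim := hw.const_mul (C + M / η)
    rw [mul_zero] at hlim
    refine squeeze_zero' (Eventually.of_forall fun _ => dist_nonneg) ?_ hlim
    filter_upwards [hW, hE, hES] with n hWn hEn hESn
    refine abs_setIntegral_sub_le hWn (hH n).2 (B := B ∩ Θ) ?_ hEn hS hη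
      (fun a ha b hb => hESn a ha b hb.1) hg hM hC (fun a ha b hb => hLip a ha b hb.2)
    rw [Set.compl_inter]
    exact measure_union_null hB hG.2
  have hweight : Tendsto (fun n => (H n).real (E n)) atTop (𝓝 (G.real S)) := by
    have := key (fun _ => 1) continuous_const 1 0 (by simp) le_rfl (by simp)
    simpa using this
  have hGS' : 0 < G.real S := ENNReal.toReal_pos hGS (measure_ne_top _ _)
  have hpos : ∀ᶠ n in atTop, H n (E n) ≠ 0 := by
    filter_upwards [hweight.eventually_const_lt hGS'] with n hn h0
    simp [Measure.real, h0] at hn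
  have hdens : ∀ x, Tendsto (fun n => partDensity σ (H n) (E n) x) atTop
      (𝓝 (partDensity σ G S x)) := by
    intro x
    simp_rw [partDensity_eq]
    refine (hweight.inv₀ hGS'.ne').mul ?_
    refine key (fun θ => gaussianKernel σ (x - θ))
      (continuous_gaussianKernel.comp (continuous_const.sub continuous_id)) (gaussianConst d σ)
      -- The absolute value makes the Lipschitz constant nonnegative without a sign hypothesis on
      -- `R`.
      (gaussianConst d σ * ((‖x‖ + |R|) / σ ^ 2)) (fun θ => ?_) ?_ (fun a ha b hb => ?_)
    · rw [abs_of_pos (gaussianKernel_pos hσ _)]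
      exact gaussianKernel_le hσ _
    · have := gaussianConst_pos (d := d) hσ
      positivity
    · exact abs_gaussianKernel_sub_le hσ x ((hR a ha).trans (le_abs_self R))
        ((hR b hb).trans (le_abs_self R))
  have hl1 : Tendsto (fun n => l1Dist (partDensity σ (H n) (E n)) (partDensity σ G S)) atTop
      (𝓝 0) := by
    have h0 : (0 : ℝ) = ∫ _ : Euc d, (0 : ℝ) := by simp
    rw [h0]
    refine tendsto_integral_filter_of_dominated_convergence
      (fun x => gaussianConst d σ * Real.exp (R ^ 2 / (2 * σ ^ 2)) *
        Real.exp (-(1 / (4 * σ ^ 2)) * ‖x‖ ^ 2)) ?_ ?_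
      (integrable_gaussian_envelope (by positivity) _) (ae_of_all _ fun x => ?_)
    · filter_upwards [hpos] with n hn
      exact ((measurable_partDensity hσ hn).sub
        (measurable_partDensity hσ hGS)).norm.aestronglyMeasurable
    · filter_upwards [hpos] with n hn
      refine ae_of_all _ fun x => ?_
      rw [Real.norm_of_nonneg (abs_nonneg _), abs_le]
      have h1 := partDensity_le hσ hR (hH n) hn x
      have h2 := partDensity_le hσ hR hG hGS x
      have h3 : 0 ≤ partDensity σ (H n) (E n) x := mixDensity_nonneg hσ _ x
      have h4 : 0 ≤ partDensity σ G S x := mixDensity_nonneg hσ _ x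
      constructor <;> linarith
    · have := ((hdens x).sub_const (partDensity σ G S x)).abs
      simpa using this
  have hwt : Tendsto (fun n => |partWeight (H n) (E n) - partWeight G S|) atTop (𝓝 0) := by
    have := (hweight.sub_const (G.real S)).abs
    simpa [partWeight] using this
  simpa using hwt.max hl1

theorem support_subset_of_mem_mixingMeasures (hΘ : IsClosed Θ) {G : Measure (Euc d)}
    (hG : G ∈ mixingMeasures Θ) : G.support ⊆ Θ := by
  intro x hx
  by_contra hxΘ
  exact ((Measure.mem_support_iff_forall x).1 hx _ (hΘ.isOpen_compl.mem_nhds hxΘ)).ne' hG.2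

/-- The prefactor is positive, so an infinite distance would make the left side infinite. -/
theorem ThresholdCondition.ne_top {δ t : ℝ} {W : ℝ≥0∞} (hd : 0 < d) (hδ : 0 < δ)
    (h : ThresholdCondition d δ t W) : W ≠ ∞ := by
  rintro rfl
  have hd' : 0 < √(d : ℝ) := Real.sqrt_pos.2 (Nat.cast_pos.2 hd)
  rw [ThresholdCondition, ENNReal.mul_top (ENNReal.ofReal_pos.2 (by positivity)).ne'] at h
  exact absurd h (by simp)

theorem thresholdCondition_iff {δ t : ℝ} {W : ℝ≥0∞} (hd : 0 < d) (hδ : 0 < δ) (ht : 0 ≤ t)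
    (hW : W ≠ ∞) :
    ThresholdCondition d δ t W ↔ W.toReal ≤ t * (2 ^ d * δ ^ (d + 1) * √d) := by
  have hd' : 0 < √(d : ℝ) := Real.sqrt_pos.2 (Nat.cast_pos.2 hd)
  rw [ThresholdCondition, ← ENNReal.ofReal_toReal hW, ← ENNReal.ofReal_mul (by positivity),
    ENNReal.ofReal_le_ofReal_iff ht, inv_mul_le_iff₀ (by positivity), mul_comm t,
    ENNReal.toReal_ofReal ENNReal.toReal_nonneg]

/-- Consistency of single-linkage clustering of the level sets, for deterministic sequences. -/
theorem clustering_consistency (hd : 0 < d) (hΘ : IsCompact Θ) (hσ : 0 < σ)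
    {G : Measure (Euc d)} (hG : G ∈ mixingMeasures Θ) {N : ℕ} {S : Fin N → Set (Euc d)}
    (hS : EnumeratesComponents G.support S) {H : ℕ → Measure (Euc d)}
    (hH : ∀ n, H n ∈ mixingMeasures Θ) {δ t : ℕ → ℝ} (hδ : ∀ᶠ n in atTop, 0 < δ n)
    (ht : ∀ᶠ n in atTop, 0 < t n) (hδ0 : Tendsto δ atTop (𝓝 0)) (ht0 : Tendsto t atTop (𝓝 0))
    (hthr : ∀ᶠ n in atTop, ThresholdCondition d (δ n) (t n) (wasserstein1 (H n) G))
    {Shat : ℕ → Fin N → Set (Euc d)}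
    (hShat : ∀ n, (∃ C : Fin N → Set (Euc d), IsSingleLinkage (boxLevelSet (H n) (δ n) (t n)) C) →
      IsSingleLinkage (boxLevelSet (H n) (δ n) (t n)) (Shat n)) :
    (∀ᶠ n in atTop, IsSingleLinkage (boxLevelSet (H n) (δ n) (t n)) (Shat n)) ∧
      ∃ π : ℕ → Equiv.Perm (Fin N),
        Tendsto (fun n => ⨆ k : Fin N,
          max |partWeight (H n) (voronoiCell Θ (Shat n) (π n k)) - partWeight G (S k)|
            (l1Dist (partDensity σ (H n) (voronoiCell Θ (Shat n) (π n k)))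
              (partDensity σ G (S k)))) atTop (𝓝 0) := by
  have hHp := fun n => (hH n).1
  have hGp := hG.1
  obtain ⟨R, hR⟩ := hΘ.exists_bound_of_continuousOn continuousOn_id
  have hsuppΘ := support_subset_of_mem_mixingMeasures hΘ.isClosed hG
  have hsupp : IsCompact G.support :=
    hΘ.of_isClosed_subset Measure.isClosed_support hsuppΘ
  obtain ⟨hne, hconn, hU, hcl, ρ, hρ, hsep⟩ := hS.exists_separation hsupp
  have hSsub : ∀ k, S k ⊆ G.support := fun k => hU ▸ Set.subset_iUnion S k
  -- Near parts are then chained at height `3η`, while their mutual distance exceeds `ρ - 2η = 4η`.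
  set η := ρ / 6 with hη_def
  have hη : 0 < η := by positivity
  have hηρ : 6 * η ≤ ρ := by linarith
  have hW : ∀ᶠ n in atTop, wasserstein1 (H n) G ≠ ∞ := by
    filter_upwards [hthr, hδ] with n h1 h2 using h1.ne_top hd h2
  have hthr' : ∀ᶠ n in atTop,
      (wasserstein1 (H n) G).toReal ≤ t n * (2 ^ d * δ n ^ (d + 1) * √d) := by
    filter_upwards [hthr, hδ, ht, hW] with n h1 h2 h3 h4
    exact (thresholdCondition_iff hd h2 h3.le h4).1 h1
  have hw : Tendsto (fun n => (wasserstein1 (H n) G).toReal) atTop (𝓝 0) := by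
    refine squeeze_zero' (Eventually.of_forall fun _ => ENNReal.toReal_nonneg) hthr' ?_
    have := ht0.mul (((hδ0.pow (d + 1)).const_mul (2 ^ d)).mul_const √(d : ℝ))
    simpa using this
  have hnear : ∀ᶠ n in atTop, 2 * (√d * δ n) < η := by
    have : Tendsto (fun n => 2 * (√d * δ n)) atTop (𝓝 (2 * (√d * 0))) :=
      (hδ0.const_mul _).const_mul _
    rw [mul_zero, mul_zero] at this
    exact this.eventually_lt_const hη
  have hSL : ∀ᶠ n in atTop, ∀ k, ∀ s ∈ S k, ∃ x ∈ boxLevelSet (H n) (δ n) (t n), dist x s < η := by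
    filter_upwards [eventually_forall_exists_mem_boxLevelSet hsupp hHp hδ hδ0 ht0 hW hw hη]
      with n hn k s hs using hn s (hSsub k hs)
  have hLS : ∀ᶠ n in atTop, ∀ x ∈ boxLevelSet (H n) (δ n) (t n), ∃ k, ∃ s ∈ S k, dist x s < η := by
    filter_upwards [hδ, hW, hthr', hnear] with n h1 h2 h3 h4 x hx
    obtain ⟨s, hs, hxs⟩ := exists_mem_support_dist_le hd h1 h2 h3 hx
    rw [← hU] at hs
    obtain ⟨k, hk⟩ := Set.mem_iUnion.1 hs
    exact ⟨k, s, hk, hxs.trans_lt h4⟩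
  have hclust : ∀ᶠ n in atTop, IsSingleLinkage (boxLevelSet (H n) (δ n) (t n)) (Shat n) ∧
      ∃ π : Equiv.Perm (Fin N), ∀ k, ∀ a ∈ Θ, ∀ b ∈ G.support, dist a b < η →
        (a ∈ voronoiCell Θ (Shat n) (π k) ↔ b ∈ S k) := by
    filter_upwards [hSL, hLS] with n h1 h2
    obtain ⟨h3, h4⟩ := nearPart_isSingleLinkage hη hηρ hne hconn hsep h2 h1
    have h5 := hShat n ⟨_, h3⟩
    obtain ⟨π, hπ⟩ := h4 _ h5
    refine ⟨h5, π, fun k a ha b hb hab => ?_⟩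
    rw [voronoiCell_comp_perm Θ hπ]
    exact mem_voronoiCell_nearPart_iff hη hηρ hne hsep h1 ha (hU ▸ hb) hab k
  have hchoice : ∀ n, ∃ π : Equiv.Perm (Fin N),
      (∃ π' : Equiv.Perm (Fin N), ∀ k, ∀ a ∈ Θ, ∀ b ∈ G.support, dist a b < η →
        (a ∈ voronoiCell Θ (Shat n) (π' k) ↔ b ∈ S k)) →
      ∀ k, ∀ a ∈ Θ, ∀ b ∈ G.support, dist a b < η →
        (a ∈ voronoiCell Θ (Shat n) (π k) ↔ b ∈ S k) := fun n => by
    by_cases h : ∃ π' : Equiv.Perm (Fin N), ∀ k, ∀ a ∈ Θ, ∀ b ∈ G.support, dist a b < η →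
        (a ∈ voronoiCell Θ (Shat n) (π' k) ↔ b ∈ S k)
    · exact ⟨h.choose, fun _ => h.choose_spec⟩
    · exact ⟨1, fun h' => absurd h' h⟩
  choose π hπ using hchoice
  refine ⟨hclust.mono fun n h => h.1, π, ?_⟩
  have hk : ∀ k, Tendsto (fun n =>
      max |partWeight (H n) (voronoiCell Θ (Shat n) (π n k)) - partWeight G (S k)|
        (l1Dist (partDensity σ (H n) (voronoiCell Θ (Shat n) (π n k)))
          (partDensity σ G (S k)))) atTop (𝓝 0) := by
    intro k
    refine tendsto_parts hσ (R := R) hR hH hG hW hw Measure.measure_compl_support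
      (hcl k).measurableSet ?_ (Eventually.of_forall fun n =>
        measurableSet_voronoiCell hΘ.isClosed.measurableSet _ _) hη ?_
    -- Each component has positive mass: the `ρ`-ball around one of its points meets the support
    -- only inside that component.
    · obtain ⟨s, hs⟩ := hne k
      have h1 := (Measure.mem_support_iff_forall s).1 (hSsub k hs) _ (Metric.ball_mem_nhds s hρ)
      intro h0
      refine h1.ne' (measure_mono_null (t := S k ∪ G.supportᶜ) (fun x hx => ?_)
        (measure_union_null h0 Measure.measure_compl_support))
      by_cases hxs : x ∈ G.support
      · rw [← hU] at hxs
        obtain ⟨j, hj⟩ := Set.mem_iUnion.1 hxs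
        by_cases hjk : j = k
        · exact Or.inl (hjk ▸ hj)
        · exact absurd (Metric.mem_ball.1 hx) (not_lt.2 (hsep j k hjk x hj s hs))
      · exact Or.inr hxs
    · filter_upwards [hclust] with n hn using hπ n hn.2 k
  -- The supremum over the finite index set is bounded by the sum of the nonnegative terms.
  have hsum := tendsto_finsetSum Finset.univ fun k (_ : k ∈ Finset.univ) => hk k
  rw [Finset.sum_const_zero] at hsum
  refine squeeze_zero (fun n => Real.iSup_nonneg fun k => le_max_of_le_left (abs_nonneg _))
    (fun n => ?_) hsum
  refine Real.iSup_le (fun k => ?_) (Finset.sum_nonneg fun k _ => le_max_of_le_left (abs_nonneg _))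
  exact Finset.single_le_sum (f := fun k =>
    max |partWeight (H n) (voronoiCell Θ (Shat n) (π n k)) - partWeight G (S k)|
        (l1Dist (partDensity σ (H n) (voronoiCell Θ (Shat n) (π n k)))
          (partDensity σ G (S k)))) (fun k _ => le_max_of_le_left (abs_nonneg _)) (Finset.mem_univ k)

end Parts

/-! ### Weak convergence on a compact set implies Wasserstein convergence -/

section Weak

variable {d : ℕ}

theorem wasserstein1_zero_zero : wasserstein1 (0 : Measure (Euc d)) 0 = 0 :=
  le_antisymm ((wasserstein1_le_of_coupling (γ := 0) (by simp) (by simp)).trans (by simp)) bot_le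

/-- Couplings add. `wasserstein1` makes sense for measures of any mass, so a transport can be
assembled from pieces. -/
theorem wasserstein1_add_le (P P' Q Q' : Measure (Euc d)) :
    wasserstein1 (P + P') (Q + Q') ≤ wasserstein1 P Q + wasserstein1 P' Q' := by
  refine ENNReal.le_of_forall_pos_le_add fun ε hε hlt => ?_
  have hε2 : (ε / 2 : ℝ≥0∞) ≠ 0 := by simpa using hε.ne'
  obtain ⟨h1, h2⟩ := ENNReal.add_lt_top.1 hlt
  obtain ⟨γ, hγ1, hγ2, hγ⟩ := exists_coupling_lt (ENNReal.lt_add_right h1.ne hε2)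
  obtain ⟨γ', hγ1', hγ2', hγ'⟩ := exists_coupling_lt (ENNReal.lt_add_right h2.ne hε2)
  refine (wasserstein1_le_of_coupling (γ := γ + γ') ?_ ?_).trans ?_
  · rw [Measure.map_add _ _ measurable_fst, hγ1, hγ1']
  · rw [Measure.map_add _ _ measurable_snd, hγ2, hγ2']
  · rw [lintegral_add_measure]
    refine (add_le_add hγ.le hγ'.le).trans_eq ?_
    rw [add_add_add_comm, ENNReal.add_halves]

theorem wasserstein1_sum_le {ι : Type*} (s : Finset ι) (P Q : ι → Measure (Euc d)) :
    wasserstein1 (∑ i ∈ s, P i) (∑ i ∈ s, Q i) ≤ ∑ i ∈ s, wasserstein1 (P i) (Q i) := by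
  classical
  induction s using Finset.induction_on with
  | empty => simp [wasserstein1_zero_zero]
  | insert a s ha ih =>
    rw [Finset.sum_insert ha, Finset.sum_insert ha, Finset.sum_insert ha]
    exact (wasserstein1_add_le _ _ _ _).trans (by gcongr)

/-- The independent coupling bounds the Wasserstein distance. -/
theorem wasserstein1_le_of_edist_le (P Q : Measure (Euc d)) [IsFiniteMeasure P]
    [IsFiniteMeasure Q] (hPQ : P Set.univ = Q Set.univ) {A B : Set (Euc d)} (hA : P Aᶜ = 0)
    (hB : Q Bᶜ = 0) {D : ℝ≥0∞} (hD : ∀ a ∈ A, ∀ b ∈ B, edist a b ≤ D) :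
    wasserstein1 P Q ≤ D * P Set.univ := by
  by_cases h0 : P Set.univ = 0
  · have hP : P = 0 := Measure.measure_univ_eq_zero.1 h0
    have hQ : Q = 0 := Measure.measure_univ_eq_zero.1 (hPQ ▸ h0)
    rw [hP, hQ, wasserstein1_zero_zero]
    exact bot_le
  have hinv : (P Set.univ)⁻¹ * P Set.univ = 1 := ENNReal.inv_mul_cancel h0 (measure_ne_top _ _)
  -- The marginals of the product carry an extra factor equal to the common mass, which is divided
  -- out.
  refine (wasserstein1_le_of_coupling (γ := (P Set.univ)⁻¹ • P.prod Q) ?_ ?_).trans ?_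
  · rw [Measure.map_smul, Measure.map_fst_prod, smul_smul, ← hPQ, hinv, one_smul]
  · rw [Measure.map_smul, Measure.map_snd_prod, smul_smul, hinv, one_smul]
  · have hae : ∀ᵐ z ∂(P.prod Q), edist z.1 z.2 ≤ D := by
      have h1 : ∀ᵐ z ∂(P.prod Q), z.1 ∈ A :=
        Measure.quasiMeasurePreserving_fst.ae (p := fun x => x ∈ A) hA
      have h2 : ∀ᵐ z ∂(P.prod Q), z.2 ∈ B :=
        Measure.quasiMeasurePreserving_snd.ae (p := fun x => x ∈ B) hB
      filter_upwards [h1, h2] with z hz1 hz2 using hD _ hz1 _ hz2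
    rw [lintegral_smul_measure, smul_eq_mul]
    calc (P Set.univ)⁻¹ * ∫⁻ z, edist z.1 z.2 ∂(P.prod Q)
        ≤ (P Set.univ)⁻¹ * ∫⁻ _, D ∂(P.prod Q) := 
          mul_le_mul_right (lintegral_mono_ae hae) _
      _ = ((P Set.univ)⁻¹ * P Set.univ) * (D * P Set.univ) := by
        rw [lintegral_const, ← Set.univ_prod_univ, Measure.prod_prod, ← hPQ]
        ring
      _ = D * P Set.univ := by rw [hinv, one_mul]

/-- A finite measure carried by finitely many disjoint sets is the sum of its restrictions. -/
theorem sum_restrict_eq_of_compl_null {α ι : Type*} [MeasurableSpace α] {P : Measure α}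
    {s : Finset ι} {D : ι → Set α} (hD : ∀ i, MeasurableSet (D i)) (hdisj : Pairwise (Function.onFun Disjoint D))
    (h : P (⋃ i ∈ s, D i)ᶜ = 0) : ∑ i ∈ s, P.restrict (D i) = P := by
  ext A hA
  rw [Measure.finsetSum_apply]
  simp_rw [Measure.restrict_apply hA]
  rw [← measure_biUnion_finset (fun i _ j _ hij => (hdisj hij).mono Set.inter_subset_right
    Set.inter_subset_right) fun i _ => hA.inter (hD i)]
  rw [← Set.inter_iUnion₂]
  exact measure_inter_conull h

/-- Comparison of two measures through a finite partition into small pieces. -/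
theorem wasserstein1_le_of_partition {P Q : Measure (Euc d)} [IsProbabilityMeasure P]
    [IsProbabilityMeasure Q] {Θ : Set (Euc d)} (hP : P Θᶜ = 0) (hQ : Q Θᶜ = 0) {s : Finset ℕ}
    {D : ℕ → Set (Euc d)} (hD : ∀ i, MeasurableSet (D i)) (hdisj : Pairwise (Function.onFun Disjoint D))
    (hΘ : Θ ⊆ ⋃ i ∈ s, D i) {η M : ℝ≥0∞} (hη : ∀ i, ∀ a ∈ D i, ∀ b ∈ D i, edist a b ≤ η)
    (hM : ∀ a ∈ Θ, ∀ b ∈ Θ, edist a b ≤ M) :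
    wasserstein1 P Q ≤ η + M * ∑ i ∈ s, (P (D i) - min (P (D i)) (Q (D i))) := by
  -- The mass `m i` common to both measures is moved inside the piece `D i`, at distance at most
  -- `η`; only the excess travels between pieces, at distance at most `M`.
  set m : ℕ → ℝ≥0∞ := fun i => min (P (D i)) (Q (D i)) with hm
  have hsplit : ∀ (ν : Measure (Euc d)) [IsProbabilityMeasure ν], ν Θᶜ = 0 → (∀ i, m i ≤ ν (D i)) →
      ∃ c : ℕ → ℝ≥0∞, (∀ i, c i ≤ 1) ∧ (∀ i, c i * ν (D i) = m i) ∧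
        ν = ∑ i ∈ s, c i • ν.restrict (D i) + ∑ i ∈ s, (1 - c i) • ν.restrict (D i) := by
    intro ν _ hν hmν
    refine ⟨fun i => m i / ν (D i), fun i => ENNReal.div_le_of_le_mul (by simpa using hmν i),
      fun i => ENNReal.div_mul_cancel' (fun h => ?_) (fun h => absurd h (measure_ne_top _ _)), ?_⟩
    · exact le_antisymm (h ▸ hmν i) bot_le
    · rw [← Finset.sum_add_distrib]
      conv_lhs => rw [← sum_restrict_eq_of_compl_null (s := s) hD hdisj
        (measure_mono_null (Set.compl_subset_compl.2 hΘ) hν)]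
      refine Finset.sum_congr rfl fun i _ => ?_
      rw [← add_smul, add_tsub_cancel_of_le, one_smul]
      exact ENNReal.div_le_of_le_mul (by simpa using hmν i)
  obtain ⟨c, hc1, hc, hPc⟩ := hsplit P hP fun i => min_le_left _ _
  obtain ⟨e, he1, he, hQe⟩ := hsplit Q hQ fun i => min_le_right _ _
  have hmtop : ∀ i, m i ≠ ∞ := fun i => ((min_le_left _ _).trans_lt (measure_lt_top P _)).ne
  have hmass : ∀ (ν : Measure (Euc d)) (c : ℕ → ℝ≥0∞),
      (∑ i ∈ s, c i • ν.restrict (D i)) Set.univ = ∑ i ∈ s, c i * ν (D i) := fun ν c => by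
    rw [Measure.finsetSum_apply]
    simp
  have hfin : ∀ (ν : Measure (Euc d)) [IsProbabilityMeasure ν] (c : ℕ → ℝ≥0∞), (∀ i, c i ≤ 1) →
      IsFiniteMeasure (∑ i ∈ s, c i • ν.restrict (D i)) := fun ν _ c hc => by
    refine ⟨?_⟩
    rw [hmass]
    exact ENNReal.sum_lt_top.2 fun i _ => ENNReal.mul_lt_top ((hc i).trans_lt ENNReal.one_lt_top)
      (measure_lt_top _ _)
  have hnull : ∀ (ν : Measure (Euc d)) (c : ℕ → ℝ≥0∞), ν Θᶜ = 0 →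
      (∑ i ∈ s, c i • ν.restrict (D i)) Θᶜ = 0 := fun ν c hν => by
    rw [Measure.finsetSum_apply]
    refine Finset.sum_eq_zero fun i _ => ?_
    rw [Measure.smul_apply, Measure.absolutelyContinuous_of_le Measure.restrict_le_self hν,
      smul_zero]
  have hPtot := congrArg (fun ν => ν Set.univ) hPc
  have hQtot := congrArg (fun ν => ν Set.univ) hQe
  simp only [Measure.add_apply, measure_univ, hmass, hc, he] at hPtot hQtot
  have hsum_ne : ∑ i ∈ s, m i ≠ ∞ := ENNReal.sum_ne_top.2 fun i _ => hmtop i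
  -- Both measures have total mass one and share the same matched mass, so the leftovers have equal
  -- mass and can be coupled.
  have hrest : ∑ i ∈ s, (1 - c i) * P (D i) = ∑ i ∈ s, (1 - e i) * Q (D i) :=
    (ENNReal.add_right_inj hsum_ne).1 (hPtot.symm.trans hQtot)
  have hsum_le : ∑ i ∈ s, m i ≤ 1 := hPtot ▸ le_self_add
  have := hfin P (fun i => 1 - c i) fun i => tsub_le_self
  have := hfin Q (fun i => 1 - e i) fun i => tsub_le_self
  calc wasserstein1 P Q
      ≤ wasserstein1 (∑ i ∈ s, c i • P.restrict (D i)) (∑ i ∈ s, e i • Q.restrict (D i)) +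
        wasserstein1 (∑ i ∈ s, (1 - c i) • P.restrict (D i))
          (∑ i ∈ s, (1 - e i) • Q.restrict (D i)) := by
        conv_lhs => rw [hPc, hQe]
        exact wasserstein1_add_le _ _ _ _
    _ ≤ ∑ i ∈ s, η * m i + M * ∑ i ∈ s, (P (D i) - m i) := by
        refine add_le_add ((wasserstein1_sum_le _ _ _).trans (Finset.sum_le_sum fun i _ => ?_)) ?_
        · have := Measure.smul_finite (P.restrict (D i))
            ((hc1 i).trans_lt ENNReal.one_lt_top).ne
          have := Measure.smul_finite (Q.restrict (D i))
            ((he1 i).trans_lt ENNReal.one_lt_top).ne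
          have hz : ∀ ν : Measure (Euc d), ∀ c : ℝ≥0∞, (c • ν.restrict (D i)) (D i)ᶜ = 0 :=
            fun ν c => by
              rw [Measure.smul_apply, Measure.restrict_apply (hD i).compl]
              simp
          refine (wasserstein1_le_of_edist_le _ _ ?_ (hz P _) (hz Q _) (hη i)).trans_eq ?_
          · simp [hc, he]
          · simp [hc]
        · refine (wasserstein1_le_of_edist_le _ _ ?_ (hnull P _ hP) (hnull Q _ hQ) hM).trans_eq ?_
          · rw [hmass, hmass, hrest]
          · rw [hmass]
            congr 1
            refine Finset.sum_congr rfl fun i _ => ?_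
            rw [ENNReal.sub_mul fun _ _ => measure_ne_top _ _, one_mul, hc]
    _ ≤ η + M * ∑ i ∈ s, (P (D i) - m i) := by
        gcongr
        rw [← Finset.mul_sum]
        exact mul_le_of_le_one_right' hsum_le

/-- Disjoint measurable sets of small diameter with null boundary that cover a compact set. -/
theorem exists_small_disjoint_cover {Θ : Set (Euc d)} (hΘ : IsCompact Θ) (G : Measure (Euc d))
    [IsProbabilityMeasure G] {η : ℝ} (hη : 0 < η) :
    ∃ (s : Finset ℕ) (D : ℕ → Set (Euc d)), (∀ i, MeasurableSet (D i)) ∧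
      Pairwise (Function.onFun Disjoint D) ∧ Θ ⊆ (⋃ i ∈ s, D i) ∧ (∀ i, G (frontier (D i)) = 0) ∧
      ∀ i, ∀ a ∈ D i, ∀ b ∈ D i, edist a b ≤ ENNReal.ofReal (2 * η) := by
  let x := TopologicalSpace.denseSeq (Euc d)
  -- Some sphere with radius in this interval is `G`-null. Radii above `η / 2` around dense centres
  -- cover everything; disjointification uses finitely many differences per set and keeps boundaries
  -- null.
  have hr : ∀ i, ∃ r ∈ Set.Ioo (η / 2) η, G (frontier (Metric.ball (x i) r)) = 0 := fun i => by
    obtain ⟨r, hr, h⟩ := exists_null_frontier_thickening G {x i} (half_lt_self hη)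
    rw [Metric.thickening_singleton] at h
    exact ⟨r, hr, h⟩
  choose r hr hfr using hr
  let B := fun i => Metric.ball (x i) (r i)
  have hcov : (Set.univ : Set (Euc d)) ⊆ ⋃ i, disjointed B i := fun y _ => by
    rw [iUnion_disjointed]
    obtain ⟨i, hi⟩ := (TopologicalSpace.denseRange_denseSeq (Euc d)).exists_dist_lt y (half_pos hη)
    exact Set.mem_iUnion.2 ⟨i, hi.trans (hr i).1⟩
  obtain ⟨t, ht⟩ := hΘ.elim_finite_subcover B (fun i => Metric.isOpen_ball)
    (by rw [← iUnion_disjointed]; exact (Set.subset_univ _).trans hcov)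
  refine ⟨Finset.range (t.sup id + 1), disjointed B,
    fun i => MeasurableSet.disjointed (fun i => measurableSet_ball) i, disjoint_disjointed B,
    fun y hy => ?_, fun i => ?_, fun i a ha b hb => ?_⟩
  · obtain ⟨i, hi, hyi⟩ := Set.mem_iUnion₂.1 (ht hy)
    have h1 : y ∈ partialSups B (t.sup id) :=
      le_partialSups_of_le B (Finset.le_sup (f := id) hi) hyi
    rwa [biUnion_range_succ_disjointed]
  · refine disjointedRec (p := fun A => G (frontier A) = 0) (fun A j hA => ?_) (hfr i)
    rw [Set.sdiff_eq]
    exact null_frontier_inter hA (by rw [frontier_compl]; exact hfr j)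
  · have ha' := disjointed_subset B i ha
    have hb' := disjointed_subset B i hb
    rw [edist_dist]
    refine ENNReal.ofReal_le_ofReal ?_
    rw [Metric.mem_ball] at ha' hb'
    linarith [dist_triangle_right a b (x i), (hr i).2]

/-- The pieces have `G`-null boundary, so by the portmanteau theorem their masses converge weakly
and the unmatched mass tends to zero. Moves within pieces cost at most `ε / 2`, and the unmatched
mass, travelling at most `2R`, costs at most `ε / 2`. -/
theorem eventually_wasserstein1_le {Θ : Set (Euc d)} (hΘ : IsCompact Θ)
    (G : ProbabilityMeasure (Euc d)) (hG : (G : Measure (Euc d)) Θᶜ = 0) {ε : ℝ} (hε : 0 < ε) :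
    ∀ᶠ H : ProbabilityMeasure (Euc d) in 𝓝 G, (H : Measure (Euc d)) Θᶜ = 0 →
      wasserstein1 (H : Measure (Euc d)) G ≤ ENNReal.ofReal ε := by
  obtain ⟨s, D, hD, hdisj, hcov, hfr, hsmall⟩ :=
    exists_small_disjoint_cover hΘ (G : Measure (Euc d)) (η := ε / 4) (by positivity)
  obtain ⟨R, hR⟩ := hΘ.exists_bound_of_continuousOn continuousOn_id
  have hM : ∀ a ∈ Θ, ∀ b ∈ Θ, edist a b ≤ ENNReal.ofReal (2 * R) := fun a ha b hb => by
    rw [edist_dist]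
    refine ENNReal.ofReal_le_ofReal ?_
    have h1 := hR a ha
    have h2 := hR b hb
    simp only [id_eq] at h1 h2
    linarith [dist_le_norm_add_norm a b]
  have hlim : Tendsto (fun H : ProbabilityMeasure (Euc d) => ENNReal.ofReal (2 * R) *
      ∑ i ∈ s, ((H : Measure (Euc d)) (D i) -
        min ((H : Measure (Euc d)) (D i)) ((G : Measure (Euc d)) (D i)))) (𝓝 G) (𝓝 0) := by
    have h1 : ∀ i, Tendsto (fun H : ProbabilityMeasure (Euc d) => (H : Measure (Euc d)) (D i))
        (𝓝 G) (𝓝 ((G : Measure (Euc d)) (D i))) := fun i =>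
      ProbabilityMeasure.tendsto_measure_of_null_frontier_of_tendsto' tendsto_id (hfr i)
    have h2 : ∀ i ∈ s, Tendsto (fun H : ProbabilityMeasure (Euc d) => (H : Measure (Euc d)) (D i) -
        min ((H : Measure (Euc d)) (D i)) ((G : Measure (Euc d)) (D i))) (𝓝 G) (𝓝 0) := by
      intro i _
      have := ENNReal.Tendsto.sub (h1 i)
        ((h1 i).min (tendsto_const_nhds (x := (G : Measure (Euc d)) (D i))))
        (Or.inl (measure_ne_top _ _))
      simpa using this
    have h3 := tendsto_finsetSum s h2
    rw [Finset.sum_const_zero] at h3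
    have h4 := ENNReal.Tendsto.const_mul (a := ENNReal.ofReal (2 * R)) h3
      (Or.inr ENNReal.ofReal_ne_top)
    rwa [mul_zero] at h4
  filter_upwards [hlim.eventually_le_const (ENNReal.ofReal_pos.2 (half_pos hε))] with H hH hHΘ
  refine (wasserstein1_le_of_partition hHΘ hG hD hdisj hcov hsmall hM).trans ?_
  refine (add_le_add_right hH _).trans_eq ?_
  rw [← ENNReal.ofReal_add (by positivity) (by positivity)]
  congr 1
  ring

end Weak

/-! ### Identifiability of the mixing measure -/

/-- A set of positive measure contains a point all of whose relative neighbourhoods have positive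
measure. Since singletons are null, that point is an accumulation point of the zeros, and the
identity theorem applies. -/
theorem analytic_eq_zero_of_volume_ne_zero {g : ℝ → ℝ} (hg : AnalyticOnNhd ℝ g Set.univ)
    (h : volume {t | g t = 0} ≠ 0) (t : ℝ) : g t = 0 := by
  obtain ⟨x, hx, hpos⟩ := exists_mem_forall_mem_nhdsWithin_pos_measure h
  have hfreq : ∃ᶠ z in 𝓝[≠] x, g z = 0 := by
    intro hev
    have h1 : {z | g z = 0} \ {x} ∉ 𝓝[{t | g t = 0}] x → False := fun hn => by
      have h2 : ({x} : Set ℝ) ∈ 𝓝[{t | g t = 0}] x := by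
        rw [eventually_nhdsWithin_iff] at hev
        filter_upwards [mem_nhdsWithin_of_mem_nhds hev, self_mem_nhdsWithin] with z hz hz0
        by_contra hzx
        exact hz hzx hz0
      exact (hpos _ h2).ne' (by simp)
    refine h1 fun h2 => ?_
    exact (mem_of_mem_nhdsWithin hx h2).2 rfl
  exact hg.eqOn_zero_of_preconnected_of_frequently_eq_zero isPreconnected_univ (Set.mem_univ x)
    hfreq (Set.mem_univ t)

/-- A measurable function on `ℝ^n` that is analytic in each variable separately and vanishes on a
set of positive measure is zero. -/
theorem eq_zero_of_separately_analytic {n : ℕ} {f : (Fin n → ℝ) → ℝ} (hf : Measurable f)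
    (han : ∀ x i, AnalyticOnNhd ℝ (fun t => f (Function.update x i t)) Set.univ)
    (h : volume {x | f x = 0} ≠ 0) (x : Fin n → ℝ) : f x = 0 := by
  induction n with
  | zero =>
    obtain ⟨y, hy⟩ := nonempty_of_measure_ne_zero h
    rwa [Subsingleton.elim x y]
  | succ n ih =>
    have hcons : Measurable fun z : ℝ × (Fin n → ℝ) => (Fin.cons z.1 z.2 : Fin (n + 1) → ℝ) := by
      refine measurable_pi_iff.2 fun i => ?_
      refine Fin.cases ?_ (fun j => ?_) i
      · simpa using measurable_fst
      · simp only [Fin.cons_succ]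
        exact (measurable_pi_apply j).comp measurable_snd
    have hmp := (volume_preserving_piFinSuccAbove (fun _ : Fin (n + 1) => ℝ) 0).symm
    have hZ : MeasurableSet {z : ℝ × (Fin n → ℝ) | f (Fin.cons z.1 z.2) = 0} :=
      (hf.comp hcons) (measurableSet_singleton 0)
    have h0 : (volume : Measure (ℝ × (Fin n → ℝ))) {z | f (Fin.cons z.1 z.2) = 0} ≠ 0 := by
      have := hmp.measure_preimage (s := {x | f x = 0})
        (hf (measurableSet_singleton 0)).nullMeasurableSet
      rw [← this] at h
      convert! h using 2
      ext z
      simp [MeasurableEquiv.piFinSuccAbove, Fin.insertNthEquiv]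
    -- Fubini: if almost every line slice were not identically zero, the one-variable case would
    -- make almost every slice of the zero set null, hence the zero set itself.
    have hB : volume {y : Fin n → ℝ | ∀ t : ℝ, f (Fin.cons t y) = 0} ≠ 0 := by
      intro hB
      refine h0 ?_
      rw [Measure.volume_eq_prod, Measure.prod_apply_symm hZ, lintegral_eq_zero_iff
        (measurable_measure_prodMk_right hZ)]
      have : ∀ᵐ y : Fin n → ℝ, ¬ ∀ t : ℝ, f (Fin.cons t y) = 0 := by
        simpa [ae_iff] using hB
      filter_upwards [this] with y hy
      by_contra hne
      refine hy (analytic_eq_zero_of_volume_ne_zero (g := fun t => f (Fin.cons t y)) ?_ hne)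
      have := han (Fin.cons 0 y) 0
      simpa using this
    -- For each fixed `t` the zeros in `y` contain the set just shown to have positive measure, so
    -- induction applies.
    have hslice : ∀ t : ℝ, ∀ y : Fin n → ℝ, f (Fin.cons t y) = 0 := fun t y => by
      refine ih (f := fun y => f (Fin.cons t y))
        (hf.comp (hcons.comp (measurable_const.prodMk measurable_id))) (fun y i => ?_)
        (fun h => hB (measure_mono_null (fun y hy => hy t) h)) y
      have := han (Fin.cons t y) i.succ
      simpa [Fin.cons_update] using this
    rw [← Fin.cons_self_tail x]
    exact hslice _ _

section Ident

variable {d : ℕ} {σ R : ℝ}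

/-- The mixing measure weighted by the Gaussian kernel centred at `x`. -/
noncomputable def kernelTilt (σ : ℝ) (P : Measure (Euc d)) (x : Euc d) : Measure (Euc d) :=
  P.withDensity fun θ => ENNReal.ofReal (gaussianKernel σ (x - θ))

theorem measurable_gaussianKernel_sub (x : Euc d) :
    Measurable fun θ : Euc d => gaussianKernel σ (x - θ) :=
  (continuous_gaussianKernel.comp (continuous_const.sub continuous_id)).measurable

theorem isFiniteMeasure_kernelTilt (hσ : 0 < σ) (P : Measure (Euc d)) [IsFiniteMeasure P]
    (x : Euc d) : IsFiniteMeasure (kernelTilt σ P x) :=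
  isFiniteMeasure_withDensity_ofReal (integrable_gaussianKernel_sub hσ P x).2

theorem integral_kernelTilt (hσ : 0 < σ) (P : Measure (Euc d)) (x : Euc d) (g : Euc d → ℝ) :
    ∫ θ, g θ ∂(kernelTilt σ P x) = ∫ θ, gaussianKernel σ (x - θ) * g θ ∂P := by
  rw [kernelTilt, integral_withDensity_eq_integral_toReal_smul
    (measurable_gaussianKernel_sub x).ennreal_ofReal (ae_of_all _ fun _ => ENNReal.ofReal_lt_top)]
  refine integral_congr_ae (ae_of_all _ fun θ => ?_)
  simp [ENNReal.toReal_ofReal (gaussianKernel_pos hσ (x - θ)).le]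

/-- Along a line, a Gaussian mixture is an explicit factor times a moment generating function. -/
theorem mixDensity_line (hσ : 0 < σ) (P : Measure (Euc d)) (x u : Euc d) (t : ℝ) :
    mixDensity σ P (x + t • u) =
      Real.exp (-(t * (inner ℝ x u / σ ^ 2)) - t ^ 2 * (‖u‖ ^ 2 / (2 * σ ^ 2))) *
        mgf (fun θ => inner ℝ θ u / σ ^ 2) (kernelTilt σ P x) t := by
  rw [mgf, integral_kernelTilt hσ, ← integral_const_mul, mixDensity, convMeasure]
  refine integral_congr_ae (ae_of_all _ fun θ => ?_)
  simp only
  rw [gaussianKernel_eq, gaussianKernel_eq, mul_comm (Real.exp _) (_ * _), mul_assoc, mul_assoc,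
    ← Real.exp_add, ← Real.exp_add, show x + t • u - θ = (x - θ) + t • u by abel,
    norm_add_sq_real, norm_smul, inner_smul_right, inner_sub_left, mul_pow, Real.norm_eq_abs,
    sq_abs]
  congr 2
  field_simp
  ring

theorem integrableExpSet_kernelTilt (hσ : 0 < σ) {P : Measure (Euc d)} [IsFiniteMeasure P]
    (hP : ∀ᵐ θ ∂P, ‖θ‖ ≤ R) (x u : Euc d) :
    integrableExpSet (fun θ => inner ℝ θ u / σ ^ 2) (kernelTilt σ P x) = Set.univ := by
  refine Set.eq_univ_of_forall fun t => ?_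
  have := isFiniteMeasure_kernelTilt hσ P x
  have hae : ∀ᵐ θ ∂(kernelTilt σ P x), ‖θ‖ ≤ R := (withDensity_absolutelyContinuous _ _).ae_le hP
  refine Integrable.of_bound (C := Real.exp (|t| * (R * ‖u‖ / σ ^ 2)))
    (by fun_prop) (hae.mono fun θ hθ => ?_)
  rw [Real.norm_of_nonneg (Real.exp_pos _).le]
  refine Real.exp_le_exp.2 ((le_abs_self _).trans ?_)
  rw [abs_mul, abs_div, abs_of_pos (pow_pos hσ 2)]
  have h1 : |inner ℝ θ u| ≤ R * ‖u‖ :=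
    (abs_real_inner_le_norm θ u).trans (by gcongr)
  gcongr

theorem analyticOnNhd_mixDensity_line (hσ : 0 < σ) {P : Measure (Euc d)} [IsFiniteMeasure P]
    (hP : ∀ᵐ θ ∂P, ‖θ‖ ≤ R) (x u : Euc d) :
    AnalyticOnNhd ℝ (fun t : ℝ => mixDensity σ P (x + t • u)) Set.univ := by
  simp_rw [mixDensity_line hσ]
  refine AnalyticOnNhd.mul ?_ ?_
  · intro t _
    fun_prop
  · have := analyticOnNhd_mgf (X := fun θ : Euc d => inner ℝ θ u / σ ^ 2) (μ := kernelTilt σ P x)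
    rwa [integrableExpSet_kernelTilt hσ hP, interior_univ] at this

/-- The difference of the densities is analytic along every line, in particular in each coordinate.
This is needed because `p₀` may vanish on a large set, so that equality is only observed where `p₀`
lives. -/
theorem mixDensity_eq_of_volume_ne_zero (hσ : 0 < σ) {P Q : Measure (Euc d)} [IsFiniteMeasure P]
    [IsFiniteMeasure Q] (hP : ∀ᵐ θ ∂P, ‖θ‖ ≤ R) (hQ : ∀ᵐ θ ∂Q, ‖θ‖ ≤ R)
    (h : volume {x | mixDensity σ P x = mixDensity σ Q x} ≠ 0) (x : Euc d) :
    mixDensity σ P x = mixDensity σ Q x := by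
  have hmeas : Measurable fun x => mixDensity σ P x - mixDensity σ Q x :=
    (continuous_mixDensity hσ P).measurable.sub (continuous_mixDensity hσ Q).measurable
  have key := eq_zero_of_separately_analytic
    (f := fun y : Fin d → ℝ => mixDensity σ P (WithLp.toLp 2 y) - mixDensity σ Q (WithLp.toLp 2 y))
    (hmeas.comp (MeasurableEquiv.toLp 2 (Fin d → ℝ)).measurable) (fun y i => ?_) ?_
    (WithLp.ofLp x)
  · exact sub_eq_zero.1 key
  · have hupd : ∀ t : ℝ, WithLp.toLp 2 (Function.update y i t) =
        WithLp.toLp 2 (Function.update y i 0) + t • EuclideanSpace.single i (1 : ℝ) := fun t => by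
      ext j
      by_cases hj : j = i
      · subst hj; simp
      · simp [hj]
    rw [funext fun t => congrArg₂ (· - ·) (congrArg (mixDensity σ P) (hupd t))
      (congrArg (mixDensity σ Q) (hupd t))]
    exact (analyticOnNhd_mixDensity_line hσ hP _ _).sub (analyticOnNhd_mixDensity_line hσ hQ _ _)
  · have hmp := (EuclideanSpace.volume_preserving_symm_measurableEquiv_toLp (Fin d)).symm
    have := hmp.measure_preimage (s := {x | mixDensity σ P x - mixDensity σ Q x = 0})
      (hmeas (measurableSet_singleton 0)).nullMeasurableSet
    have h1 : {x | mixDensity σ P x = mixDensity σ Q x} =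
        {x | mixDensity σ P x - mixDensity σ Q x = 0} := by
      ext x
      exact sub_eq_zero.symm
    rw [h1, ← this] at h
    exact h

/-- Along lines through the origin, equal densities mean equal moment generating functions of the
tilted measures. Analytic continuation to the imaginary axis gives equal characteristic functions,
and the tilt is undone because the kernel is positive. -/
theorem eq_of_mixDensity_eq (hσ : 0 < σ) {P Q : Measure (Euc d)} [IsFiniteMeasure P]
    [IsFiniteMeasure Q] (hP : ∀ᵐ θ ∂P, ‖θ‖ ≤ R)
    (h : ∀ x, mixDensity σ P x = mixDensity σ Q x) : P = Q := by
  have := isFiniteMeasure_kernelTilt hσ P 0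
  have := isFiniteMeasure_kernelTilt hσ Q 0
  have hmgf : ∀ u : Euc d, mgf (fun θ => inner ℝ θ u / σ ^ 2) (kernelTilt σ P 0) =
      mgf (fun θ => inner ℝ θ u / σ ^ 2) (kernelTilt σ Q 0) := fun u => by
    ext t
    have h1 := h (0 + t • u)
    rw [mixDensity_line hσ, mixDensity_line hσ] at h1
    exact mul_left_cancel₀ (Real.exp_pos _).ne' h1
  have hzero : kernelTilt σ P 0 = 0 ↔ kernelTilt σ Q 0 = 0 := by
    have h1 := congrFun (hmgf 0) 0
    simp only [mgf_zero'] at h1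
    rw [← Measure.measure_univ_eq_zero, ← Measure.measure_univ_eq_zero,
      ← measureReal_eq_zero_iff, ← measureReal_eq_zero_iff, h1]
  have htilt : kernelTilt σ P 0 = kernelTilt σ Q 0 := by
    refine Measure.ext_of_charFun (funext fun u => ?_)
    -- The direction `σ² u` cancels the `1 / σ²` in the exponent, so that the value at `I` is the
    -- characteristic function at `u`.
    have h1 := eqOn_complexMGF_of_mgf' (hmgf (σ ^ 2 • u)) hzero
    rw [integrableExpSet_kernelTilt hσ hP, interior_univ] at h1
    have h2 := h1 (x := Complex.I) (by simp)
    have h3 : ∀ θ : Euc d, inner ℝ θ (σ ^ 2 • u) / σ ^ 2 = inner ℝ θ u := fun θ => by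
      rw [inner_smul_right]
      field_simp
    simp_rw [h3, complexMGF] at h2
    simp_rw [charFun_apply, mul_comm _ Complex.I]
    exact h2
  have hinv : ∀ (ν : Measure (Euc d)), (kernelTilt σ ν 0).withDensity
      (fun θ => ENNReal.ofReal (gaussianKernel σ (0 - θ)))⁻¹ = ν := fun ν =>
    withDensity_inv_same (measurable_gaussianKernel_sub 0).ennreal_ofReal
      (ae_of_all _ fun θ => (ENNReal.ofReal_pos.2 (gaussianKernel_pos hσ _)).ne')
      (ae_of_all _ fun θ => ENNReal.ofReal_ne_top)
  rw [← hinv P, ← hinv Q, htilt]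

end Ident

/-! ### The Kullback-Leibler projection -/

section KL

variable {d : ℕ} {σ R : ℝ} {p₀ : Euc d → ℝ}

theorem IsDensity.isProbabilityMeasure (hp₀ : IsDensity p₀) :
    IsProbabilityMeasure (densityMeasure p₀) :=
  ⟨by rw [densityMeasure, withDensity_apply _ MeasurableSet.univ, setLIntegral_univ,
    hp₀.lintegral_eq_one]⟩

/-- By Tonelli and translation invariance the mass is the same for all `H`. Only this matters: the
mass corrections in `klDiv` cancel when two divergences are compared. -/
theorem densityMeasure_mixDensity_univ (hσ : 0 < σ) (H : Measure (Euc d))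
    [IsProbabilityMeasure H] : densityMeasure (mixDensity σ H) Set.univ =
      ∫⁻ z : Euc d, ENNReal.ofReal (gaussianKernel σ z) := by
  rw [densityMeasure, withDensity_apply _ MeasurableSet.univ, setLIntegral_univ]
  have hmeas : Measurable fun z : Euc d × Euc d => ENNReal.ofReal (gaussianKernel σ (z.1 - z.2)) :=
    (continuous_gaussianKernel.comp (continuous_fst.sub continuous_snd)).measurable.ennreal_ofReal
  calc ∫⁻ x, ENNReal.ofReal (mixDensity σ H x)
      = ∫⁻ x, (∫⁻ θ, ENNReal.ofReal (gaussianKernel σ (x - θ)) ∂H) := by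
        refine lintegral_congr fun x => ?_
        rw [mixDensity, convMeasure, ofReal_integral_eq_lintegral_ofReal
          (integrable_gaussianKernel_sub hσ H x) (ae_of_all _ fun _ => (gaussianKernel_pos hσ _).le)]
    _ = ∫⁻ θ, (∫⁻ x, ENNReal.ofReal (gaussianKernel σ (x - θ))) ∂H :=
        lintegral_lintegral_swap (f := fun x θ => ENNReal.ofReal (gaussianKernel σ (x - θ)))
          hmeas.aemeasurable
    _ = ∫⁻ _ : Euc d, (∫⁻ z : Euc d, ENNReal.ofReal (gaussianKernel σ z)) ∂H := by
        refine lintegral_congr fun θ => ?_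
        exact lintegral_sub_right_eq_self (fun z => ENNReal.ofReal (gaussianKernel σ z)) θ
    _ = ∫⁻ z : Euc d, ENNReal.ofReal (gaussianKernel σ z) := by simp

theorem integrable_gaussianKernel (hσ : 0 < σ) :
    Integrable (gaussianKernel (d := d) σ) := by
  have h := integrable_gaussian_envelope (d := d) (b := 1 / (2 * σ ^ 2)) (by positivity)
    (gaussianConst d σ)
  refine h.congr (ae_of_all _ fun z => ?_)
  simp only [gaussianKernel_eq]
  congr 2
  ring

theorem isFiniteMeasure_densityMeasure_mixDensity (hσ : 0 < σ) (H : Measure (Euc d))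
    [IsProbabilityMeasure H] : IsFiniteMeasure (densityMeasure (mixDensity σ H)) := by
  refine ⟨?_⟩
  rw [densityMeasure_mixDensity_univ hσ]
  exact (integrable_gaussianKernel hσ).lintegral_lt_top

variable {H : Measure (Euc d)} [IsProbabilityMeasure H]

theorem densityMeasure_eq_withDensity (hσ : 0 < σ) (hH : ∀ᵐ θ ∂H, ‖θ‖ ≤ R)
    (hp₀ : IsDensity p₀) : densityMeasure p₀ = (densityMeasure (mixDensity σ H)).withDensity
      fun x => ENNReal.ofReal (p₀ x / mixDensity σ H x) := by
  have hm := (continuous_mixDensity hσ H).measurable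
  have h := withDensity_mul volume (f := fun x => ENNReal.ofReal (mixDensity σ H x))
    (g := fun x => ENNReal.ofReal (p₀ x / mixDensity σ H x)) hm.ennreal_ofReal
    (hp₀.measurable.div hm).ennreal_ofReal
  rw [densityMeasure, densityMeasure, ← h]
  congr 1
  ext x
  rw [Pi.mul_apply, ← ENNReal.ofReal_mul (mixDensity_nonneg hσ H x),
    mul_div_cancel₀ _ (mixDensity_pos hσ hH x).ne']

theorem densityMeasure_absolutelyContinuous (hσ : 0 < σ) (hH : ∀ᵐ θ ∂H, ‖θ‖ ≤ R)
    (hp₀ : IsDensity p₀) : densityMeasure p₀ ≪ densityMeasure (mixDensity σ H) := by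
  rw [densityMeasure_eq_withDensity hσ hH hp₀]
  exact withDensity_absolutelyContinuous _ _

theorem IsDensity.ae_pos (hp₀ : IsDensity p₀) : ∀ᵐ x ∂(densityMeasure p₀), 0 < p₀ x := by
  rw [densityMeasure, ae_withDensity_iff hp₀.measurable.ennreal_ofReal]
  refine ae_of_all _ fun x hx => ?_
  simpa using hx

theorem llr_mixDensity (hσ : 0 < σ) (hH : ∀ᵐ θ ∂H, ‖θ‖ ≤ R) (hp₀ : IsDensity p₀) :
    llr (densityMeasure p₀) (densityMeasure (mixDensity σ H)) =ᵐ[densityMeasure p₀]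
      fun x => Real.log (p₀ x) - Real.log (mixDensity σ H x) := by
  have := isFiniteMeasure_densityMeasure_mixDensity hσ H
  have hm := (continuous_mixDensity hσ H).measurable
  have h1 := Measure.rnDeriv_withDensity (densityMeasure (mixDensity σ H))
    (hp₀.measurable.div hm).ennreal_ofReal
  have h2 : (densityMeasure p₀).rnDeriv (densityMeasure (mixDensity σ H))
      =ᵐ[densityMeasure (mixDensity σ H)] fun x => ENNReal.ofReal (p₀ x / mixDensity σ H x) := by
    conv_lhs => rw [densityMeasure_eq_withDensity hσ hH hp₀]
    exact h1
  filter_upwards [(densityMeasure_absolutelyContinuous hσ hH hp₀).ae_le h2, hp₀.ae_pos] with x hx hp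
  have hpos := mixDensity_pos hσ hH x
  rw [llr, hx, ENNReal.toReal_ofReal (by positivity), Real.log_div hp.ne' hpos.ne']

/-- A density with finite divergence from a Gaussian mixture has a second moment. -/
theorem integrable_sq_norm_of_klToMixture_ne_top (hσ : 0 < σ) (hH : ∀ᵐ θ ∂H, ‖θ‖ ≤ R)
    (hp₀ : IsDensity p₀) (hkl : klToMixture p₀ σ H ≠ ∞) :
    Integrable (fun x => ‖x‖ ^ 2) (densityMeasure p₀) := by
  have := isFiniteMeasure_densityMeasure_mixDensity hσ H
  have := hp₀.isProbabilityMeasure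
  obtain ⟨hac, hint⟩ := InformationTheory.klDiv_ne_top_iff.1 hkl
  have hkf := (InformationTheory.integrable_klFun_rnDeriv_iff hac).2 hint
  set r := fun x => ((densityMeasure p₀).rnDeriv (densityMeasure (mixDensity σ H)) x).toReal
    with hr
  -- Half the envelope rate `1 / (4σ²)`: multiplying the envelope by `exp (b ‖x‖²)` leaves the decay
  -- `exp (-b ‖x‖²)`.
  set b := 1 / (8 * σ ^ 2) with hb
  have hb0 : 0 < b := by positivity
  have hm := (continuous_mixDensity hσ H).measurable
  have hexp : Integrable (fun x : Euc d => Real.exp (b * ‖x‖ ^ 2))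
      (densityMeasure (mixDensity σ H)) := by
    rw [densityMeasure, integrable_withDensity_iff_integrable_smul' hm.ennreal_ofReal
      (ae_of_all _ fun _ => ENNReal.ofReal_lt_top)]
    refine (integrable_gaussian_envelope (d := d) hb0
      (gaussianConst d σ * Real.exp (R ^ 2 / (2 * σ ^ 2)))).mono' ?_ (ae_of_all _ fun x => ?_)
    · exact (hm.ennreal_ofReal.ennreal_toReal.smul (by fun_prop)).aestronglyMeasurable
    · have h0 := mixDensity_nonneg hσ H x
      rw [ENNReal.toReal_ofReal h0, smul_eq_mul, Real.norm_of_nonneg (by positivity)]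
      refine (mul_le_mul_of_nonneg_right (mixDensity_le_exp hσ hH x)
        (Real.exp_pos _).le).trans_eq ?_
      rw [mul_assoc, ← Real.exp_add]
      congr 2
      rw [hb]
      field_simp
      ring
  -- Young's inequality for `klFun` and its convex conjugate `exp c - 1`. With `c = b ‖x‖²` it
  -- bounds the second moment by the divergence plus an exponential moment of the mixture.
  have hyoung : ∀ r c : ℝ, 0 ≤ r → r * c ≤ InformationTheory.klFun r + (Real.exp c - 1) := by
    intro r c hr0
    rw [InformationTheory.klFun_apply]
    rcases hr0.eq_or_lt with rfl | hr0
    · have := (Real.exp_pos c).le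
      simp only [zero_mul, Real.log_zero]
      linarith
    · have h1 := Real.add_one_le_exp (c - Real.log r)
      rw [Real.exp_sub, Real.exp_log hr0, le_div_iff₀ hr0] at h1
      linarith
  have hprod : Integrable (fun x => r x • (b * ‖x‖ ^ 2)) (densityMeasure (mixDensity σ H)) := by
    refine (hkf.add (hexp.sub (integrable_const 1))).mono' ?_ (ae_of_all _ fun x => ?_)
    · exact ((Measure.measurable_rnDeriv _ _).ennreal_toReal.smul
        (by fun_prop)).aestronglyMeasurable
    · have h0 : 0 ≤ r x := ENNReal.toReal_nonneg
      rw [smul_eq_mul, Real.norm_of_nonneg (by positivity)]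
      exact hyoung _ _ h0
  have := Measure.haveLebesgueDecomposition_of_sigmaFinite (densityMeasure p₀)
    (densityMeasure (mixDensity σ H))
  have h2 := (integrable_rnDeriv_smul_iff hac).1 hprod
  refine (h2.const_mul b⁻¹).congr (ae_of_all _ fun x => ?_)
  simp only
  rw [inv_mul_cancel_left₀ hb0.ne']

theorem integrable_log_mixDensity (hσ : 0 < σ) (hH : ∀ᵐ θ ∂H, ‖θ‖ ≤ R) {P : Measure (Euc d)}
    [IsProbabilityMeasure P] (hP : Integrable (fun x => ‖x‖ ^ 2) P) :
    Integrable (fun x => Real.log (mixDensity σ H x)) P := by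
  refine ((integrable_const (|Real.log (gaussianConst d σ)| + R ^ 2 / σ ^ 2)).add
    (hP.const_mul (1 / σ ^ 2))).mono'
    (continuous_mixDensity hσ H).measurable.log.aestronglyMeasurable (ae_of_all _ fun x => ?_)
  exact abs_log_mixDensity_le hσ hH x

/-- The expected log-likelihood of the mixing measure `H`. -/
noncomputable def expLogLik (p₀ : Euc d → ℝ) (σ : ℝ) (H : Measure (Euc d)) : ℝ :=
  ∫ x, Real.log (mixDensity σ H x) ∂(densityMeasure p₀)

variable {Θ : Set (Euc d)} {G : Measure (Euc d)}

/-- Finite divergence makes `log p₀` integrable, so differences of divergences are differences of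
expected log-likelihoods. -/
theorem IsKLProjection.expLogLik_le (hσ : 0 < σ) (hR : ∀ θ ∈ Θ, ‖θ‖ ≤ R) (hp₀ : IsDensity p₀)
    (hG : IsKLProjection p₀ Θ σ G) (hkl : klToMixture p₀ σ G ≠ ∞) {H : Measure (Euc d)}
    (hH : H ∈ mixingMeasures Θ) : expLogLik p₀ σ H ≤ expLogLik p₀ σ G := by
  have := hH.1
  have := hG.1.1
  have := hp₀.isProbabilityMeasure
  have := isFiniteMeasure_densityMeasure_mixDensity hσ H
  have := isFiniteMeasure_densityMeasure_mixDensity hσ G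
  have hHR := mixingMeasures_ae_norm_le hR hH
  have hGR := mixingMeasures_ae_norm_le hR hG.1
  have hmom := integrable_sq_norm_of_klToMixture_ne_top hσ hGR hp₀ hkl
  have hlG := integrable_log_mixDensity hσ hGR hmom
  have hlH := integrable_log_mixDensity hσ hHR hmom
  have hacH := densityMeasure_absolutelyContinuous hσ hHR hp₀
  obtain ⟨hacG, hintG⟩ := InformationTheory.klDiv_ne_top_iff.1 hkl
  have hl0 : Integrable (fun x => Real.log (p₀ x)) (densityMeasure p₀) := by
    refine ((hintG.congr (llr_mixDensity hσ hGR hp₀)).add hlG).congr (ae_of_all _ fun x => ?_)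
    simp
  have hintH : Integrable (llr (densityMeasure p₀) (densityMeasure (mixDensity σ H)))
      (densityMeasure p₀) := (hl0.sub hlH).congr (llr_mixDensity hσ hHR hp₀).symm
  have hle : (InformationTheory.klDiv (densityMeasure p₀) (densityMeasure (mixDensity σ G))).toReal ≤
      (InformationTheory.klDiv (densityMeasure p₀) (densityMeasure (mixDensity σ H))).toReal :=
    ENNReal.toReal_mono (InformationTheory.klDiv_ne_top hacH hintH) (hG.2 H hH)
  rw [InformationTheory.toReal_klDiv hacG hintG,
    InformationTheory.toReal_klDiv hacH hintH, integral_congr_ae (llr_mixDensity hσ hGR hp₀),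
    integral_congr_ae (llr_mixDensity hσ hHR hp₀), integral_sub hl0 hlG, integral_sub hl0 hlH,
    Measure.real, Measure.real, Measure.real, densityMeasure_mixDensity_univ hσ,
    densityMeasure_mixDensity_univ hσ] at hle
  rw [expLogLik, expLogLik]
  linarith

theorem half_log_add_half_log_le {a b : ℝ} (ha : 0 < a) (hb : 0 < b) :
    Real.log a / 2 + Real.log b / 2 ≤ Real.log ((a + b) / 2) := by
  have h := And.right strictConcaveOn_log_Ioi.concaveOn (Set.mem_Ioi.2 ha) (Set.mem_Ioi.2 hb)
    (by norm_num : (0 : ℝ) ≤ 1 / 2) (by norm_num : (0 : ℝ) ≤ 1 / 2) (by norm_num)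
  simp only [smul_eq_mul] at h
  calc _ = 1 / 2 * Real.log a + 1 / 2 * Real.log b := by ring
    _ ≤ _ := h
    _ = _ := by congr 1; ring

theorem half_log_add_half_log_lt {a b : ℝ} (ha : 0 < a) (hb : 0 < b) (hab : a ≠ b) :
    Real.log a / 2 + Real.log b / 2 < Real.log ((a + b) / 2) := by
  have h := And.right strictConcaveOn_log_Ioi (Set.mem_Ioi.2 ha) (Set.mem_Ioi.2 hb) hab
    (by norm_num : (0 : ℝ) < 1 / 2) (by norm_num : (0 : ℝ) < 1 / 2) (by norm_num)
  simp only [smul_eq_mul] at h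
  calc _ = 1 / 2 * Real.log a + 1 / 2 * Real.log b := by ring
    _ < _ := h
    _ = _ := by congr 1; ring

/-- The equal mixture of two measures. -/
noncomputable def midMeasure (P Q : Measure (Euc d)) : Measure (Euc d) :=
  (2⁻¹ : ℝ≥0∞) • P + (2⁻¹ : ℝ≥0∞) • Q

theorem midMeasure_mem {P Q : Measure (Euc d)} (hP : P ∈ mixingMeasures Θ)
    (hQ : Q ∈ mixingMeasures Θ) : midMeasure P Q ∈ mixingMeasures Θ := by
  have := hP.1
  have := hQ.1
  refine ⟨⟨?_⟩, ?_⟩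
  · simp [midMeasure, ENNReal.inv_two_add_inv_two]
  · simp [midMeasure, hP.2, hQ.2]

theorem mixDensity_midMeasure (hσ : 0 < σ) {P Q : Measure (Euc d)} [IsProbabilityMeasure P]
    [IsProbabilityMeasure Q] (x : Euc d) :
    mixDensity σ (midMeasure P Q) x = (mixDensity σ P x + mixDensity σ Q x) / 2 := by
  have h2 : (2⁻¹ : ℝ≥0∞) ≠ ∞ := by simp
  rw [mixDensity, convMeasure, midMeasure, integral_add_measure
    ((integrable_gaussianKernel_sub hσ P x).smul_measure h2)
    ((integrable_gaussianKernel_sub hσ Q x).smul_measure h2), integral_smul_measure,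
    integral_smul_measure]
  simp only [ENNReal.toReal_inv, ENNReal.toReal_ofNat, smul_eq_mul, mixDensity, convMeasure]
  ring

/-- The maximizer of the expected log-likelihood is unique. -/
theorem IsKLProjection.eq_of_expLogLik_le (hσ : 0 < σ) (hR : ∀ θ ∈ Θ, ‖θ‖ ≤ R)
    (hp₀ : IsDensity p₀) (hG : IsKLProjection p₀ Θ σ G) (hkl : klToMixture p₀ σ G ≠ ∞)
    {H : Measure (Euc d)} (hH : H ∈ mixingMeasures Θ)
    (hle : expLogLik p₀ σ G ≤ expLogLik p₀ σ H) : H = G := by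
  have := hH.1
  have := hG.1.1
  have := hp₀.isProbabilityMeasure
  have hM := midMeasure_mem hG.1 hH
  have := hM.1
  have hHR := mixingMeasures_ae_norm_le hR hH
  have hGR := mixingMeasures_ae_norm_le hR hG.1
  have hmom := integrable_sq_norm_of_klToMixture_ne_top hσ hGR hp₀ hkl
  have hlG := integrable_log_mixDensity hσ hGR hmom
  have hlH := integrable_log_mixDensity hσ hHR hmom
  have hlM := integrable_log_mixDensity hσ (mixingMeasures_ae_norm_le hR hM) hmom
  have hML := hG.expLogLik_le hσ hR hp₀ hkl hM
  -- The Jensen gap of the logarithm at the midpoint. It is nonnegative, but its integral is not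
  -- positive, since the midpoint cannot beat `G` and `H` is at least as good as `G`. So it vanishes
  -- almost everywhere.
  set D := fun x => Real.log (mixDensity σ (midMeasure G H) x) -
    (Real.log (mixDensity σ G x) / 2 + Real.log (mixDensity σ H x) / 2) with hD
  have hD0 : 0 ≤ D := fun x => by
    have := half_log_add_half_log_le (mixDensity_pos hσ hGR x) (mixDensity_pos hσ hHR x)
    simp only [hD, mixDensity_midMeasure hσ, Pi.zero_apply]
    linarith
  have hlGH : Integrable (fun x => Real.log (mixDensity σ G x) / 2 +
      Real.log (mixDensity σ H x) / 2) (densityMeasure p₀) :=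
    (hlG.div_const 2).add (hlH.div_const 2)
  have hDint : Integrable D (densityMeasure p₀) := hlM.sub hlGH
  have hDle : ∫ x, D x ∂(densityMeasure p₀) ≤ 0 := by
    simp only [hD]
    rw [integral_sub hlM hlGH,
      integral_add (hlG.div_const 2) (hlH.div_const 2), integral_div, integral_div]
    simp only [expLogLik] at hle hML
    linarith
  have hDae := (integral_eq_zero_iff_of_nonneg hD0 hDint).1
    (le_antisymm hDle (integral_nonneg hD0))
  have heq : ∀ᵐ x ∂(densityMeasure p₀), mixDensity σ H x = mixDensity σ G x := by
    filter_upwards [hDae] with x hx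
    by_contra hne
    have := half_log_add_half_log_lt (mixDensity_pos hσ hGR x) (mixDensity_pos hσ hHR x)
      (Ne.symm hne)
    simp only [hD, mixDensity_midMeasure hσ, Pi.zero_apply] at hx
    linarith
  refine eq_of_mixDensity_eq hσ hHR (mixDensity_eq_of_volume_ne_zero hσ hHR hGR fun h0 => ?_)
  have h1 : densityMeasure p₀ {x | mixDensity σ H x = mixDensity σ G x} = 0 :=
    withDensity_absolutelyContinuous _ _ h0
  obtain ⟨x, hx, hx'⟩ := (heq.and (measure_eq_zero_iff_ae_notMem.1 h1)).exists
  exact hx' hx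

/-- Prokhorov's theorem, with the compact set `Θ` and zero escaping mass at every level. -/
theorem isCompact_mixingMeasures (hΘ : IsCompact Θ) :
    IsCompact {H : ProbabilityMeasure (Euc d) | (H : Measure (Euc d)) Θᶜ = 0} := by
  have h := isCompact_setOfPred_probabilityMeasure_mass_eq_compl_isCompact_le
    (u := fun _ => 0) (K := fun _ => Θ) tendsto_const_nhds (fun _ => hΘ)
    (Or.inr fun _ _ _ => le_rfl)
  convert h using 1
  ext H
  simp

/-- The expected log-likelihood is continuous along pointwise convergence of the densities. -/
theorem tendsto_expLogLik (hσ : 0 < σ) (hp₀ : IsDensity p₀)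
    (hmom : Integrable (fun x => ‖x‖ ^ 2) (densityMeasure p₀)) {ι : Type*} {l : Filter ι}
    [l.IsCountablyGenerated] {P : ι → Measure (Euc d)} (hP : ∀ i, IsProbabilityMeasure (P i))
    (hPR : ∀ᶠ i in l, ∀ᵐ θ ∂(P i), ‖θ‖ ≤ R) {H : Measure (Euc d)} [IsProbabilityMeasure H]
    (hH : ∀ᵐ θ ∂H, ‖θ‖ ≤ R)
    (hlim : ∀ x, Tendsto (fun i => mixDensity σ (P i) x) l (𝓝 (mixDensity σ H x))) :
    Tendsto (fun i => expLogLik p₀ σ (P i)) l (𝓝 (expLogLik p₀ σ H)) := by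
  have := hp₀.isProbabilityMeasure
  have hbound := (integrable_const (μ := densityMeasure p₀)
    (|Real.log (gaussianConst d σ)| + R ^ 2 / σ ^ 2)).add (hmom.const_mul (1 / σ ^ 2))
  refine tendsto_integral_filter_of_dominated_convergence _ ?_ ?_ hbound (ae_of_all _ fun x => ?_)
  · exact Eventually.of_forall fun i =>
      (continuous_mixDensity hσ (P i)).measurable.log.aestronglyMeasurable
  · filter_upwards [hPR] with i hi
    exact ae_of_all _ fun x => abs_log_mixDensity_le hσ hi x
  · exact ((Real.continuousAt_log (mixDensity_pos hσ hH x).ne').tendsto).comp (hlim x)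

theorem continuous_mixDensity_probabilityMeasure (hσ : 0 < σ) (x : Euc d) :
    Continuous fun H : ProbabilityMeasure (Euc d) => mixDensity σ (H : Measure (Euc d)) x := by
  let φ : BoundedContinuousFunction (Euc d) ℝ := BoundedContinuousFunction.ofNormedAddCommGroup
    (fun θ => gaussianKernel σ (x - θ))
    (continuous_gaussianKernel.comp (continuous_const.sub continuous_id)) (gaussianConst d σ)
    (fun θ => by
      rw [Real.norm_of_nonneg (gaussianKernel_pos hσ _).le]
      exact gaussianKernel_le hσ _)
  exact continuous_iff_continuousAt.2 fun H =>
    ProbabilityMeasure.tendsto_iff_forall_integral_tendsto.1 tendsto_id φ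

/-- Each density value is the integral of a bounded continuous kernel, hence weakly continuous.
Dominated convergence applies since the weak neighbourhood filters are countably generated. -/
theorem continuousOn_expLogLik (hσ : 0 < σ) (hR : ∀ θ ∈ Θ, ‖θ‖ ≤ R) (hp₀ : IsDensity p₀)
    (hmom : Integrable (fun x => ‖x‖ ^ 2) (densityMeasure p₀)) :
    ContinuousOn (fun H : ProbabilityMeasure (Euc d) => expLogLik p₀ σ (H : Measure (Euc d)))
      {H | (H : Measure (Euc d)) Θᶜ = 0} := by
  intro H hH
  have hR' : ∀ P : ProbabilityMeasure (Euc d), (P : Measure (Euc d)) Θᶜ = 0 →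
      ∀ᵐ θ ∂(P : Measure (Euc d)), ‖θ‖ ≤ R := fun P hP =>
    mixingMeasures_ae_norm_le hR ⟨inferInstance, hP⟩
  exact tendsto_expLogLik hσ hp₀ hmom
    (l := 𝓝[{P : ProbabilityMeasure (Euc d) | (P : Measure (Euc d)) Θᶜ = 0}] H) (fun P : ProbabilityMeasure (Euc d) => inferInstance)
    (eventually_nhdsWithin_of_forall fun P hP => hR' P hP) (hR' H hH)
    fun x => ((continuous_mixDensity_probabilityMeasure hσ x).tendsto H).mono_left
      nhdsWithin_le_nhds

/-- Mixing measures away from the projection have a strictly smaller expected log-likelihood. -/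
theorem IsKLProjection.exists_gap (hΘ : IsCompact Θ) (hσ : 0 < σ) (hp₀ : IsDensity p₀)
    (hG : IsKLProjection p₀ Θ σ G) (hkl : klToMixture p₀ σ G ≠ ∞) {ε : ℝ} (hε : 0 < ε) :
    ∃ κ : ℝ, 0 < κ ∧ ∀ H ∈ mixingMeasures Θ, ¬ wasserstein1 H G ≤ ENNReal.ofReal ε →
      expLogLik p₀ σ H ≤ expLogLik p₀ σ G - κ := by
  obtain ⟨R, hR⟩ := hΘ.exists_bound_of_continuousOn continuousOn_id
  simp only [id_eq] at hR
  have hGp := hG.1.1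
  have hmom := integrable_sq_norm_of_klToMixture_ne_top hσ
    (mixingMeasures_ae_norm_le hR hG.1) hp₀ hkl
  let G' : ProbabilityMeasure (Euc d) := ⟨G, hGp⟩
  obtain ⟨V, hV, hVo, hGV⟩ := eventually_nhds_iff.1 (eventually_wasserstein1_le hΘ G' hG.1.2 hε)
  -- The measures outside a weak neighbourhood of `G` form a compact set. The best of them is
  -- strictly worse than `G` by uniqueness, and the difference is the gap.
  have hK := (isCompact_mixingMeasures hΘ).diff hVo
  have hmem : ∀ H (hH : H ∈ mixingMeasures Θ), ¬ wasserstein1 H G ≤ ENNReal.ofReal ε →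
      (⟨H, hH.1⟩ : ProbabilityMeasure (Euc d)) ∈
        {H : ProbabilityMeasure (Euc d) | (H : Measure (Euc d)) Θᶜ = 0} \ V := fun H hH hW =>
    ⟨hH.2, fun hHV => hW (hV _ hHV hH.2)⟩
  rcases Set.eq_empty_or_nonempty
    ({H : ProbabilityMeasure (Euc d) | (H : Measure (Euc d)) Θᶜ = 0} \ V) with he | hne
  · exact ⟨1, one_pos, fun H hH hW => (he.subset (hmem H hH hW)).elim⟩
  obtain ⟨H₀, ⟨hH₀, hH₀V⟩, hmax⟩ := hK.exists_isMaxOn hne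
    ((continuousOn_expLogLik hσ hR hp₀ hmom).mono Set.sdiff_subset)
  have hlt : expLogLik p₀ σ H₀ < expLogLik p₀ σ G := by
    by_contra! hle
    have h1 := hG.eq_of_expLogLik_le hσ hR hp₀ hkl (H := H₀) ⟨inferInstance, hH₀⟩ hle
    have h2 : H₀ = G' := Subtype.ext h1
    exact hH₀V (h2 ▸ hGV)
  refine ⟨expLogLik p₀ σ G - expLogLik p₀ σ H₀, by linarith, fun H hH hW => ?_⟩
  have : expLogLik p₀ σ H ≤ expLogLik p₀ σ H₀ := hmax (hmem H hH hW)
  linarith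

end KL

/-! ### A uniform law of large numbers for log-likelihoods of Gaussian mixtures -/

section ULLN

variable {d : ℕ} {σ R : ℝ} {Θ : Set (Euc d)}

/-- On a ball, the log-densities of the mixtures are uniformly approximated by finitely many. -/
theorem exists_finite_net_on_closedBall (hσ : 0 < σ) (hR0 : 0 ≤ R) (hR : ∀ θ ∈ Θ, ‖θ‖ ≤ R)
    {K η : ℝ} (hK : 0 ≤ K) (hη : 0 < η) :
    ∃ T : Set (Measure (Euc d)), T.Finite ∧ T ⊆ mixingMeasures Θ ∧ ∀ H ∈ mixingMeasures Θ,
      ∃ H' ∈ T, ∀ x, ‖x‖ ≤ K →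
        |Real.log (mixDensity σ H x) - Real.log (mixDensity σ H' x)| ≤ η := by
  set Lip := (K + R) / σ ^ 2 with hLip
  have hLip0 : 0 ≤ Lip := by positivity
  set r := η / (4 * (Lip + 1)) with hr
  have hr0 : 0 < r := by positivity
  have hLr : Lip * r ≤ η / 4 := by
    rw [hr, mul_div_assoc', div_le_div_iff₀ (by positivity) (by norm_num)]
    nlinarith
  obtain ⟨C, hCK, hCf, hcov⟩ :=
    (isCompact_closedBall (0 : Euc d) K).finite_cover_balls hr0
  have := hCf.fintype
  -- Evaluation at finitely many points maps the mixtures into a bounded, hence totally bounded,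
  -- set. The errors add up as `η/4 + η/2 + η/4`: Lipschitz, net, Lipschitz.
  let Φ : Measure (Euc d) → (C → ℝ) := fun H y => Real.log (mixDensity σ H y)
  have hbdd : Bornology.IsBounded (Φ '' mixingMeasures Θ) := by
    rw [isBounded_iff_forall_norm_le]
    refine ⟨|Real.log (gaussianConst d σ)| + R ^ 2 / σ ^ 2 + 1 / σ ^ 2 * K ^ 2, ?_⟩
    rintro _ ⟨H, hH, rfl⟩
    have := hH.1
    refine (pi_norm_le_iff_of_nonneg (by positivity)).2 fun y => ?_
    have hy : ‖(y : Euc d)‖ ≤ K := by simpa using hCK y.2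
    refine (abs_log_mixDensity_le hσ (mixingMeasures_ae_norm_le hR hH) (y : Euc d)).trans ?_
    gcongr
  obtain ⟨t, hts, htf, htc⟩ := Metric.finite_approx_of_totallyBounded
    (hbdd.isCompact_closure.totallyBounded.subset subset_closure) (η / 2) (half_pos hη)
  obtain ⟨T, hTM, hTf, rfl⟩ := htf.exists_subset_finite_image_eq hts
  refine ⟨T, hTf, hTM, fun H hH => ?_⟩
  have h1 := htc (Set.mem_image_of_mem Φ hH)
  obtain ⟨_, ⟨H', hH', rfl⟩, hHH'⟩ := Set.mem_iUnion₂.1 h1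
  refine ⟨H', hH', fun x hx => ?_⟩
  obtain ⟨y, hyC, hxy⟩ := Set.mem_iUnion₂.1 (hcov (by simpa using hx : x ∈ Metric.closedBall 0 K))
  have hy : ‖y‖ ≤ K := by simpa using hCK hyC
  have := hH.1
  have := (hTM hH').1
  have h2 := abs_log_mixDensity_sub_le hσ (mixingMeasures_ae_norm_le hR hH) hx hy
  have h3 := abs_log_mixDensity_sub_le hσ (mixingMeasures_ae_norm_le hR (hTM hH')) hx hy
  have h4 : Lip * dist x y ≤ η / 4 :=
    (mul_le_mul_of_nonneg_left (Metric.mem_ball.1 hxy).le hLip0).trans hLr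
  have h5 := (dist_le_pi_dist (Φ H) (Φ H') ⟨y, hyC⟩).trans (Metric.mem_ball.1 hHH').le
  rw [Real.dist_eq] at h5
  simp only [Φ] at h5
  rw [abs_le] at *
  constructor <;> linarith [h2.1, h2.2, h3.1, h3.2, h5.1, h5.2]

/-- The log-densities of the mixtures have finite nets in `L¹`, with an integrable error bound. -/
theorem exists_finite_net (hσ : 0 < σ) (hR0 : 0 ≤ R) (hR : ∀ θ ∈ Θ, ‖θ‖ ≤ R)
    {P : Measure (Euc d)} [IsProbabilityMeasure P] (hmom : Integrable (fun x => ‖x‖ ^ 2) P)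
    {η : ℝ} (hη : 0 < η) :
    ∃ (T : Set (Measure (Euc d))) (g : Euc d → ℝ), T.Finite ∧ T ⊆ mixingMeasures Θ ∧
      Measurable g ∧ Integrable g P ∧ ∫ x, g x ∂P ≤ η ∧ ∀ H ∈ mixingMeasures Θ, ∃ H' ∈ T,
        ∀ x, |Real.log (mixDensity σ H x) - Real.log (mixDensity σ H' x)| ≤ g x := by
  set env : Euc d → ℝ := fun x =>
    |Real.log (gaussianConst d σ)| + R ^ 2 / σ ^ 2 + 1 / σ ^ 2 * ‖x‖ ^ 2 with henv
  have henv_int : Integrable env P := (integrable_const _).add (hmom.const_mul (1 / σ ^ 2))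
  have henv_meas : Measurable env := by fun_prop
  let U : ℕ → Set (Euc d) := fun k => {x | (k : ℝ) < ‖x‖}
  have hU : ∀ k, MeasurableSet (U k) := fun k => measurableSet_lt measurable_const measurable_norm
  have htail : Tendsto (fun k => ∫ x in U k, 2 * env x ∂P) atTop (𝓝 0) := by
    have h := Antitone.tendsto_setIntegral (μ := P) (f := fun x => 2 * env x) hU
      (fun i j hij x (hx : (j : ℝ) < ‖x‖) => (Nat.cast_le.2 hij).trans_lt hx)
      (henv_int.const_mul 2).integrableOn
    have hempty : ⋂ k, U k = ∅ := by
      refine Set.eq_empty_iff_forall_notMem.2 fun x hx => ?_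
      obtain ⟨k, hk⟩ := exists_nat_ge ‖x‖
      exact absurd (Set.mem_iInter.1 hx k) (not_lt.2 hk)
    rwa [hempty, setIntegral_empty] at h
  -- Outside the ball of radius `k` two log-densities differ by at most `2 * env`, whose tail
  -- integral takes half of the budget; the net on the ball takes the other half.
  obtain ⟨k, hk⟩ := (htail.eventually_le_const (half_pos hη)).exists
  obtain ⟨T, hTf, hTM, hT⟩ :=
    exists_finite_net_on_closedBall hσ hR0 hR (Nat.cast_nonneg k) (half_pos hη)
  have hind : Integrable ((U k).indicator fun x => 2 * env x) P :=
    (henv_int.const_mul 2).indicator (hU k)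
  refine ⟨T, fun x => η / 2 + (U k).indicator (fun x => 2 * env x) x, hTf, hTM,
    measurable_const.add ((henv_meas.const_mul 2).indicator (hU k)),
    (integrable_const _).add hind, ?_, fun H hH => ?_⟩
  · rw [integral_add (integrable_const _) hind, integral_indicator (hU k)]
    simp only [integral_const, probReal_univ, one_smul]
    linarith
  · obtain ⟨H', hH', h⟩ := hT H hH
    refine ⟨H', hH', fun x => ?_⟩
    beta_reduce
    by_cases hx : x ∈ U k
    · have := hH.1
      have := (hTM hH').1
      have h1 := abs_log_mixDensity_le hσ (mixingMeasures_ae_norm_le hR hH) x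
      have h2 := abs_log_mixDensity_le hσ (mixingMeasures_ae_norm_le hR (hTM hH')) x
      rw [Set.indicator_of_mem hx]
      refine (abs_sub _ _).trans ?_
      simp only [henv]
      linarith
    · rw [Set.indicator_of_notMem hx, add_zero]
      exact h x (not_lt.1 hx)

variable {Ω : Type*} [MeasurableSpace Ω] {μ : Measure Ω}
  {Y : ℕ → Ω → Euc d} {P : Measure (Euc d)}

/-- The empirical mean of `f` over the first `n` observations. -/
noncomputable def empMean (y : ℕ → Euc d) (f : Euc d → ℝ) (n : ℕ) : ℝ :=
  (∑ i ∈ Finset.range n, f (y i)) / n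

theorem abs_empMean_sub_le (y : ℕ → Euc d) {f f' g : Euc d → ℝ} (h : ∀ x, |f x - f' x| ≤ g x)
    (n : ℕ) : |empMean y f n - empMean y f' n| ≤ empMean y g n := by
  rw [empMean, empMean, ← sub_div, ← Finset.sum_sub_distrib, abs_div, Nat.abs_cast]
  unfold empMean
  gcongr
  exact (Finset.abs_sum_le_sum_abs _ _).trans (Finset.sum_le_sum fun i _ => h _)

theorem ae_tendsto_empMean (hY_law : ∀ i, HasLaw (Y i) P μ) (hY_indep : iIndepFun Y μ)
    {f : Euc d → ℝ} (hf : Measurable f) (hfi : Integrable f P) :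
    ∀ᵐ ω ∂μ, Tendsto (fun n => empMean (fun i => Y i ω) f n) atTop (𝓝 (∫ x, f x ∂P)) := by
  have hint : Integrable (f ∘ Y 0) μ := by
    rw [← integrable_map_measure _ (hY_law 0).aemeasurable, (hY_law 0).map_eq]
    · exact hfi
    · exact hf.aestronglyMeasurable
  have h := strong_law_ae_real (fun i => f ∘ Y i) hint
    (fun i j hij => ((hY_indep.comp (fun _ => f) fun _ => hf).indepFun hij))
    (fun i => ((hY_law i).identDistrib (hY_law 0)).comp hf)
  rw [(hY_law 0).integral_comp hf.aestronglyMeasurable] at h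
  exact h

theorem aemeasurable_empMean (hY_law : ∀ i, HasLaw (Y i) P μ) {f : Euc d → ℝ} (hf : Measurable f)
    (n : ℕ) : AEMeasurable (fun ω => empMean (fun i => Y i ω) f n) μ := by
  unfold empMean
  exact (Finset.aemeasurable_fun_sum _ fun i _ =>
    hf.comp_aemeasurable (hY_law i).aemeasurable).div_const _

/-- The event that the empirical mean of `f` is off by more than `κ`. -/
def deviationEvent (Y : ℕ → Ω → Euc d) (P : Measure (Euc d)) (f : Euc d → ℝ) (κ : ℝ) (n : ℕ) :
    Set Ω :=
  {ω | κ < |empMean (fun i => Y i ω) f n - ∫ x, f x ∂P|}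

theorem nullMeasurableSet_deviationEvent (hY_law : ∀ i, HasLaw (Y i) P μ) {f : Euc d → ℝ}
    (hf : Measurable f) (κ : ℝ) (n : ℕ) : NullMeasurableSet (deviationEvent Y P f κ n) μ :=
  nullMeasurableSet_lt aemeasurable_const
    (continuous_abs.measurable.comp_aemeasurable
      ((aemeasurable_empMean hY_law hf n).sub_const _))

theorem ae_eventually_notMem_deviationEvent (hY_law : ∀ i, HasLaw (Y i) P μ)
    (hY_indep : iIndepFun Y μ) {f : Euc d → ℝ} (hf : Measurable f) (hfi : Integrable f P) {κ : ℝ}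
    (hκ : 0 < κ) : ∀ᵐ ω ∂μ, ∀ᶠ n in atTop, ω ∉ deviationEvent Y P f κ n := by
  filter_upwards [ae_tendsto_empMean hY_law hY_indep hf hfi] with ω hω
  have h := (hω.sub_const (∫ x, f x ∂P)).abs
  rw [sub_self, abs_zero] at h
  filter_upwards [h.eventually_le_const hκ] with n hn using not_lt.2 hn

/-- Uniform law of large numbers, with measurable exceptional events. -/
theorem exists_uniform_deviation_events (hY_law : ∀ i, HasLaw (Y i) P μ)
    (hY_indep : iIndepFun Y μ) [IsProbabilityMeasure P] (hσ : 0 < σ) (hR0 : 0 ≤ R)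
    (hR : ∀ θ ∈ Θ, ‖θ‖ ≤ R) (hmom : Integrable (fun x => ‖x‖ ^ 2) P) {κ : ℝ} (hκ : 0 < κ) :
    ∃ B : ℕ → Set Ω, (∀ n, NullMeasurableSet (B n) μ) ∧ (∀ᵐ ω ∂μ, ∀ᶠ n in atTop, ω ∉ B n) ∧
      ∀ n, ∀ ω ∉ B n, ∀ H ∈ mixingMeasures Θ,
        |empMean (fun i => Y i ω) (fun x => Real.log (mixDensity σ H x)) n -
          ∫ x, Real.log (mixDensity σ H x) ∂P| ≤ κ := by
  obtain ⟨T, g, hTf, hTM, hg, hgi, hgη, hT⟩ :=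
    exists_finite_net hσ hR0 hR hmom (η := κ / 4) (by positivity)
  have hmeas : ∀ H ∈ mixingMeasures Θ, Measurable fun x => Real.log (mixDensity σ H x) :=
    fun H hH => by
      have := hH.1
      exact (continuous_mixDensity hσ H).measurable.log
  have hint : ∀ H ∈ mixingMeasures Θ, Integrable (fun x => Real.log (mixDensity σ H x)) P :=
    fun H hH => by
      have := hH.1
      exact integrable_log_mixDensity hσ (mixingMeasures_ae_norm_le hR hH) hmom
  -- Finitely many events control the whole family, which avoids an uncountable supremum. The budget
  -- is `κ/2` for the empirical mean of `g`, `κ/4` for the net element and `κ/4` for the integral of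
  -- `g`.
  refine ⟨fun n => deviationEvent Y P g (κ / 4) n ∪
    ⋃ H ∈ T, deviationEvent Y P (fun x => Real.log (mixDensity σ H x)) (κ / 4) n,
    fun n => ?_, ?_, fun n ω hω H hH => ?_⟩
  · refine (nullMeasurableSet_deviationEvent hY_law hg _ n).union ?_
    exact NullMeasurableSet.biUnion hTf.countable fun H hH =>
      nullMeasurableSet_deviationEvent hY_law (hmeas H (hTM hH)) _ n
  · have h1 : ∀ᵐ ω ∂μ, ∀ H ∈ T, ∀ᶠ n in atTop,
        ω ∉ deviationEvent Y P (fun x => Real.log (mixDensity σ H x)) (κ / 4) n :=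
      (ae_ball_iff hTf.countable).2 fun H hH => ae_eventually_notMem_deviationEvent hY_law hY_indep
        (hmeas H (hTM hH)) (hint H (hTM hH)) (by positivity)
    filter_upwards [h1, ae_eventually_notMem_deviationEvent hY_law hY_indep hg hgi
      (show 0 < κ / 4 by positivity)] with ω hω1 hω2
    filter_upwards [(eventually_all_finite hTf).2 hω1, hω2] with n hn1 hn2
    simp only [Set.mem_union, Set.mem_iUnion, not_or, not_exists]
    exact ⟨hn2, hn1⟩
  · simp only [Set.mem_union, Set.mem_iUnion, not_or, not_exists] at hω
    obtain ⟨H', hH', hHH'⟩ := hT H hH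
    have h1 : |empMean (fun i => Y i ω) g n - ∫ x, g x ∂P| ≤ κ / 4 := not_lt.1 hω.1
    have h2 : |empMean (fun i => Y i ω) (fun x => Real.log (mixDensity σ H' x)) n -
      ∫ x, Real.log (mixDensity σ H' x) ∂P| ≤ κ / 4 := not_lt.1 (hω.2 H' hH')
    have h3 := abs_empMean_sub_le (fun i => Y i ω) hHH' n
    have h4 : |∫ x, Real.log (mixDensity σ H x) ∂P - ∫ x, Real.log (mixDensity σ H' x) ∂P| ≤
        ∫ x, g x ∂P := by
      rw [← integral_sub (hint H hH) (hint H' (hTM hH'))]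
      exact (abs_integral_le_integral_abs).trans
        (integral_mono ((hint H hH).sub (hint H' (hTM hH'))).abs hgi hHH')
    rw [abs_le] at *
    constructor <;> linarith [h1.1, h1.2, h2.1, h2.2, h3.1, h3.2, h4.1, h4.2]

/-- The nonparametric maximum likelihood estimator is consistent in Wasserstein distance, with
measurable exceptional events. -/
theorem exists_consistency_events {p₀ : Euc d → ℝ} (hΘ : IsCompact Θ) (hσ : 0 < σ)
    (hp₀ : IsDensity p₀) (hY_law : ∀ i, HasLaw (Y i) (densityMeasure p₀) μ)
    (hY_indep : iIndepFun Y μ) {G : Measure (Euc d)} (hG : IsKLProjection p₀ Θ σ G)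
    (hkl : klToMixture p₀ σ G ≠ ∞) {ε : ℝ} (hε : 0 < ε) :
    ∃ B : ℕ → Set Ω, (∀ n, NullMeasurableSet (B n) μ) ∧ (∀ᵐ ω ∂μ, ∀ᶠ n in atTop, ω ∉ B n) ∧
      ∀ n, ∀ ω ∉ B n, ∀ H, IsNPMLE Θ σ n (fun i => Y i ω) H →
        wasserstein1 H G ≤ ENNReal.ofReal ε := by
  obtain ⟨R₀, hR₀⟩ := hΘ.exists_bound_of_continuousOn continuousOn_id
  have hR : ∀ θ ∈ Θ, ‖θ‖ ≤ |R₀| := fun θ hθ => (hR₀ θ hθ).trans (le_abs_self _)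
  have := hG.1.1
  have := hp₀.isProbabilityMeasure
  have hmom := integrable_sq_norm_of_klToMixture_ne_top hσ
    (mixingMeasures_ae_norm_le hR hG.1) hp₀ hkl
  obtain ⟨κ, hκ, hgap⟩ := hG.exists_gap hΘ hσ hp₀ hkl hε
  -- Two deviations of `κ / 3`, one at `H` and one at `G`, cannot bridge the gap `κ`.
  obtain ⟨B, hB, hBae, hBdev⟩ := exists_uniform_deviation_events hY_law hY_indep hσ
    (abs_nonneg R₀) hR hmom (κ := κ / 3) (by positivity)
  refine ⟨B, hB, hBae, fun n ω hω H hH => ?_⟩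
  by_contra hW
  have h1 := hgap H hH.1 hW
  have h2 := hBdev n ω hω H hH.1
  have h3 := hBdev n ω hω G hG.1
  have h4 : empMean (fun i => Y i ω) (fun x => Real.log (mixDensity σ G x)) n ≤
      empMean (fun i => Y i ω) (fun x => Real.log (mixDensity σ H x)) n :=
    div_le_div_of_nonneg_right (hH.2 G hG.1) (Nat.cast_nonneg n)
  unfold expLogLik at h1
  rw [abs_le] at h2 h3
  linarith [h2.1, h2.2, h3.1, h3.2]

end ULLN

/-! ### Deterministic rates from almost sure convergence -/

/-- If for each `k` the measurable events `B k n` almost surely occur only finitely often, then the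
same holds along some slowly increasing level `k = κ n`. -/
theorem exists_slow_levels {Ω : Type*} [MeasurableSpace Ω] {μ : Measure Ω} [IsFiniteMeasure μ]
    {B : ℕ → ℕ → Set Ω} (hB : ∀ k n, NullMeasurableSet (B k n) μ)
    (h : ∀ k, ∀ᵐ ω ∂μ, ∀ᶠ n in atTop, ω ∉ B k n) :
    ∃ κ : ℕ → ℕ, Tendsto κ atTop atTop ∧ ∀ᵐ ω ∂μ, ∀ᶠ n in atTop, ω ∉ B (κ n) n := by
  -- Continuity from above: the tail unions decrease to a null set. Summable bounds on the chosen
  -- tails then allow Borel-Cantelli.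
  have hsmall : ∀ k, ∃ n, μ (⋃ m ≥ n, B k m) ≤ (2⁻¹ : ℝ≥0∞) ^ k := by
    intro k
    have hanti : Antitone fun n => ⋃ m ≥ n, B k m := fun a b hab =>
      Set.biUnion_subset_biUnion_left fun m (hm : b ≤ m) => hab.trans hm
    have hlim := tendsto_measure_iInter_atTop (μ := μ) (s := fun n => ⋃ m ≥ n, B k m)
      (fun n => NullMeasurableSet.biUnion (Set.to_countable _) fun m _ => hB k m) hanti
      ⟨0, measure_ne_top _ _⟩
    have hzero : μ (⋂ n, ⋃ m ≥ n, B k m) = 0 := by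
      rw [measure_eq_zero_iff_ae_notMem]
      filter_upwards [h k] with ω hω hmem
      obtain ⟨n, hn⟩ := eventually_atTop.1 hω
      obtain ⟨m, hm, hmB⟩ := Set.mem_iUnion₂.1 (Set.mem_iInter.1 hmem n)
      exact hn m hm hmB
    rw [hzero] at hlim
    have hpos : (0 : ℝ≥0∞) < 2⁻¹ ^ k := ENNReal.pow_pos (by simp) k
    exact (hlim.eventually_le_const hpos).exists
  choose N hN using hsmall
  have hsum : ∑' k, μ (⋃ m ≥ N k, B k m) ≠ ∞ := by
    refine ne_top_of_le_ne_top ?_ (ENNReal.tsum_le_tsum hN)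
    rw [ENNReal.tsum_geometric]
    simp
  -- The level at time `n` is the largest `k ≤ n` whose tail has already started, that is `N k ≤ n`.
  -- For `n ≥ N 0` the value `k = 0` qualifies, so the level does satisfy this.
  have hκ : Tendsto (fun n => Nat.findGreatest (fun k => N k ≤ n) n) atTop atTop := by
    refine tendsto_atTop.2 fun K => ?_
    filter_upwards [eventually_ge_atTop (max K (N K))] with n hn
    exact Nat.le_findGreatest ((le_max_left _ _).trans hn) ((le_max_right _ _).trans hn)
  refine ⟨_, hκ, ?_⟩
  filter_upwards [ae_eventually_notMem hsum] with ω hω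
  filter_upwards [hκ.eventually hω, eventually_ge_atTop (N 0)] with n hn hn0
  have hspec : N (Nat.findGreatest (fun k => N k ≤ n) n) ≤ n :=
    Nat.findGreatest_spec (P := fun k => N k ≤ n) (Nat.zero_le n) hn0
  exact fun hmem => hn (Set.mem_iUnion₂.2 ⟨n, hspec, hmem⟩)

/-- Of the `d + 2` factors `ε`, one is absorbed by `t` and `d + 1` by `δ`; the constants `2 ^ d` and
`√d` are at least one. -/
theorem ThresholdCondition.of_le_pow {d : ℕ} (hd : 0 < d) {δ t ε : ℝ} {W : ℝ≥0∞} (hε : 0 < ε)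
    (hδ : ε ≤ δ) (ht : ε ≤ t) (hW : W ≤ ENNReal.ofReal (ε ^ (d + 2))) :
    ThresholdCondition d δ t W := by
  have hWtop : W ≠ ∞ := ne_top_of_le_ne_top ENNReal.ofReal_ne_top hW
  have hδ0 : 0 < δ := hε.trans_le hδ
  have ht0 : 0 < t := hε.trans_le ht
  rw [thresholdCondition_iff hd hδ0 ht0.le hWtop]
  have h1 : (1 : ℝ) ≤ 2 ^ d := one_le_pow₀ (by norm_num)
  have h2 : (1 : ℝ) ≤ √(d : ℝ) := Real.one_le_sqrt.2 (by exact_mod_cast hd)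
  calc W.toReal ≤ ε ^ (d + 2) := ENNReal.toReal_le_of_le_ofReal (by positivity) hW
    _ = ε * (1 * ε ^ (d + 1) * 1) := by ring
    _ ≤ t * (2 ^ d * δ ^ (d + 1) * √d) := by gcongr

theorem theorem4p1
    {d : ℕ} (hd : 0 < d)
    (Θ : Set (Euc d)) (hΘ : IsCompact Θ)
    (p₀ : Euc d → ℝ) (hp₀ : IsDensity p₀)
    (σ : ℝ) (hσ : 0 < σ)
    -- the i.i.d. sample from `p₀`
    {Ω : Type*} [MeasurableSpace Ω] (μ : Measure Ω) [IsProbabilityMeasure μ]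
    (Y : ℕ → Ω → Euc d)
    (hY_law : ∀ i, HasLaw (Y i) (densityMeasure p₀) μ)
    (hY_indep : iIndepFun Y μ)
    -- the estimator (any maximizer of the likelihood) and the projection
    (Ghat : ℕ → Ω → Measure (Euc d))
    (hGhat : ∀ᵐ ω ∂μ, ∀ n, IsNPMLE Θ σ n (fun i => Y i ω) (Ghat n ω))
    (G : Measure (Euc d)) (hG : IsKLProjection p₀ Θ σ G)
    -- the connected components of the support of the projection
    {N : ℕ} (S : Fin N → Set (Euc d)) (hS : EnumeratesComponents G.support S) :
    (∀ δ t : ℕ → Ω → ℝ,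
      (∀ᵐ ω ∂μ, (∀ᶠ n in atTop, 0 < δ n ω) ∧ (∀ᶠ n in atTop, 0 < t n ω) ∧
        Tendsto (fun n => δ n ω) atTop (𝓝 0) ∧ Tendsto (fun n => t n ω) atTop (𝓝 0) ∧
        ∀ᶠ n in atTop, ThresholdCondition d (δ n ω) (t n ω) (wasserstein1 (Ghat n ω) G)) →
      -- `Shat n ω` is an output of single-linkage clustering, whenever there is one
      ∀ Shat : ℕ → Ω → Fin N → Set (Euc d),
      (∀ᵐ ω ∂μ, ∀ n,
        (∃ C : Fin N → Set (Euc d),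
          IsSingleLinkage (boxLevelSet (Ghat n ω) (δ n ω) (t n ω)) C) →
        IsSingleLinkage (boxLevelSet (Ghat n ω) (δ n ω) (t n ω)) (Shat n ω)) →
      ∀ᵐ ω ∂μ,
        (∀ᶠ n in atTop,
          IsSingleLinkage (boxLevelSet (Ghat n ω) (δ n ω) (t n ω)) (Shat n ω)) ∧
        -- up to the order in which the clusters are listed
        ∃ π : ℕ → Equiv.Perm (Fin N),
          Tendsto
            (fun n => ⨆ k : Fin N,
              max
                |partWeight (Ghat n ω) (voronoiCell Θ (Shat n ω) (π n k)) - partWeight G (S k)|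
                (l1Dist (partDensity σ (Ghat n ω) (voronoiCell Θ (Shat n ω) (π n k)))
                  (partDensity σ G (S k))))
            atTop (𝓝 0)) ∧
    -- all slowly decaying deterministic sequences are admissible
    (klToMixture p₀ σ G ≠ ∞ →
      ∃ ε : ℕ → ℝ, (∀ n, 0 < ε n) ∧ Tendsto ε atTop (𝓝 0) ∧
        ∀ δ t : ℕ → ℝ, (∀ᶠ n in atTop, ε n ≤ δ n) → (∀ᶠ n in atTop, ε n ≤ t n) →
          ∀ᵐ ω ∂μ, ∀ᶠ n in atTop,
            ThresholdCondition d (δ n) (t n) (wasserstein1 (Ghat n ω) G)) := by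

  refine ⟨fun δ t hδt Shat hShat => ?_, fun hkl => ?_⟩
  · filter_upwards [hGhat, hδt, hShat] with ω h1 h2 h3
    exact clustering_consistency hd hΘ hσ hG.1 hS (fun n => (h1 n).1) h2.1 h2.2.1 h2.2.2.1
      h2.2.2.2.1 h2.2.2.2.2 h3
  · have hpos : ∀ k : ℕ, (0 : ℝ) < 1 / ((k : ℝ) + 1) := fun k => Nat.one_div_pos_of_nat
    -- Level `k` asks for Wasserstein accuracy `(1 / (k + 1)) ^ (d + 2)`, which suffices for all `δ,
    -- t ≥ 1 / (k + 1)`; the rate is this bound along the slow levels.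
    choose B hB hBae hBW using fun k : ℕ => exists_consistency_events hΘ hσ hp₀ hY_law hY_indep hG
      hkl (pow_pos (hpos k) (d + 2))
    obtain ⟨κ, hκ, hκae⟩ := exists_slow_levels hB hBae
    refine ⟨fun n => 1 / ((κ n : ℝ) + 1), fun n => hpos _,
      tendsto_one_div_add_atTop_nhds_zero_nat.comp hκ, fun δ t hδ ht => ?_⟩
    filter_upwards [hκae, hGhat] with ω h1 h2
    filter_upwards [h1, hδ, ht] with n h3 h4 h5
    exact ThresholdCondition.of_le_pow hd (hpos _) h4 h5 (hBW _ n ω h3 _ (h2 n))
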